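/- Let $M$ be a smooth (Hausdorff, second countable) manifold of dimension $d$, and for open $U\subseteq M$ let $\mathcal G^0_2(U)$ be the space of Colombeau generalized $(0,2)$-tensor fields on $U$: nets $(\sigma_\varepsilon)_{\varepsilon\in(0,1]}$ of smooth $(0,2)$-tensor fields on $U$ that are moderate (in every chart, on every compact subset of its domain, every partial derivative of every component is $O(\varepsilon^{-N})$ uniformly, for some $N$), modulo negligible nets (moderate nets whose components in every chart are $O(\varepsilon^{m})$ uniformly on compact sets, for every $m$). Let $\widetilde{\mathbb R}$ be the ring of generalized numbers (moderate nets in $\mathbb R^{(0,1]}$, i.e. those that are $O(\varepsilon^{-N})$ for some $N$, modulo nets that are $O(\varepsilon^m)$ for all $m$). For $\Omega\subseteq\mathbb R^d$ open let $\widetilde\Omega_c$ be the set of compactly supported generalized points of $\Omega$ (nets in $\Omega$ that stay in a fixed compact subset of $\Omega$ for small $\varepsilon$, modulo $|x_\varepsilon-y_\varepsilon|=O(\varepsilon^m)$ for all $m$). Call $\sigma\in\mathcal G^0_2(M)$ a generalized symplectic form if it is a closed generalized $2$-form, i.e. it has a representative consisting of smooth $2$-forms $\sigma_\varepsilon$ such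 that $(d\sigma_\varepsilon)_\varepsilon$ is negligible (in every chart its components are $O(\varepsilon^m)$ uniformly on compact sets, for every $m$), and if it is non-degenerate: for every chart $(W,\psi)$ and every $\tilde z\in\widetilde{\psi(W)}_c$ the $\widetilde{\mathbb R}$-bilinear form $\psi_*\sigma(\tilde z):\widetilde{\mathbb R}^d\times\widetilde{\mathbb R}^d\to\widetilde{\mathbb R}$ is non-degenerate. Say that $\mathrm{vol}(\sigma)$ is strictly positive if for every representative $(\sigma_\varepsilon)_\varepsilon$ of $\sigma$, every chart $(W,\psi)$ and every compact $K\subseteq\psi(W)$ there is $m\in\mathbb N$ such that, for all sufficiently small $\varepsilon$, $\sqrt{|\det((\sigma_\varepsilon)_{ij})|}\ge\varepsilon^m$ on $K$, where $(\sigma_\varepsilon)_{ij}$ are the components of $\sigma_\varepsilon$ in the chart. Then for every $\sigma\in\mathcal G^0_2(M)$ the following are equivalent: (i) $\sigma$ is a generalized symplectic form on $M$. (ii) $\mathrm{vol}(\sigma)$ is strictly positive, and for every $p\in M$ there exist an open neighborhood $U$ of $p$ and a representative $(\sigma_\varepsilon)_{\varepsilon\in(0,1]}$ of $\sigma|_U$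 such that each $\sigma_\varepsilon$ is a symplectic form on $U$ (a smooth, closed $2$-form on $U$ that is non-degenerate at each point). -/

import Mathlib

open scoped Manifold ContDiff Topology

namespace Colombeau

open Filter Asymptotics TopologicalSpace

/-! ### The parameter interval and the ring of generalized numbers -/

/-- The parameter interval `]0,1]`. -/
abbrev Eps : Type := Set.Ioc (0 : ℝ) 1

/-- The filter `ε → 0` on `]0,1]`: a property holds eventually iff it holds for all small `ε`. -/
def small : Filter Eps := Filter.comap (fun ε : Eps => (ε : ℝ)) (𝓝 0)

lemma eventually_small {P : Eps → Prop} :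
    (∀ᶠ ε in small, P ε) ↔ ∃ η : ℝ, 0 < η ∧ ∀ ε : Eps, (ε : ℝ) < η → P ε := by
  unfold small
  rw [(Metric.nhds_basis_ball.comap _).eventually_iff]
  constructor
  · rintro ⟨η, h0, h⟩
    refine ⟨η, h0, fun ε hε => h ?_⟩
    simpa [abs_of_pos ε.2.1] using hε
  · rintro ⟨η, h0, h⟩
    refine ⟨η, h0, fun ε hε => h ε ?_⟩
    simpa [abs_of_pos ε.2.1] using hε

/-- Moderate nets of real numbers: `|r_ε| = O(ε^{-N})` for some `N`. -/
def ModerateNumber (r : Eps → ℝ) : Prop :=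
  ∃ N : ℕ, r =O[small] fun ε : Eps => ((ε : ℝ) ^ N)⁻¹

/-- Negligible nets of real numbers: `|r_ε| = O(ε^m)` for all `m`. -/
def NegligibleNumber (r : Eps → ℝ) : Prop :=
  ∀ m : ℕ, r =O[small] fun ε : Eps => (ε : ℝ) ^ m

lemma isBigO_inv_pow_mono {N N' : ℕ} (h : N ≤ N') :
    (fun ε : Eps => ((ε : ℝ) ^ N)⁻¹) =O[small] fun ε : Eps => ((ε : ℝ) ^ N')⁻¹ := by
  refine IsBigO.of_bound 1 (Eventually.of_forall fun ε => ?_)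
  have h0 : (0 : ℝ) < ε := ε.2.1
  rw [one_mul, Real.norm_of_nonneg (by positivity), Real.norm_of_nonneg (by positivity)]
  exact inv_anti₀ (by positivity) (pow_le_pow_of_le_one h0.le ε.2.2 h)

/-- The ring of moderate nets of real numbers. -/
def moderateSubring : Subring (Eps → ℝ) where
  carrier := {r | ModerateNumber r}
  mul_mem' := by
    rintro a b ⟨N, hN⟩ ⟨N', hN'⟩
    refine ⟨N + N', (hN.mul hN').congr_right fun ε => ?_⟩
    rw [pow_add, mul_inv]
  one_mem' := ⟨0, by simpa using isBigO_refl (fun _ : Eps => (1 : ℝ)) small⟩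
  add_mem' := by
    rintro a b ⟨N, hN⟩ ⟨N', hN'⟩
    exact ⟨max N N', (hN.trans (isBigO_inv_pow_mono (le_max_left _ _))).add
      (hN'.trans (isBigO_inv_pow_mono (le_max_right _ _)))⟩
  zero_mem' := ⟨0, isBigO_zero _ _⟩
  neg_mem' := by
    rintro a ⟨N, hN⟩
    exact ⟨N, hN.neg_left⟩

/-- The ideal of negligible nets of real numbers. -/
def negligibleIdeal : Ideal moderateSubring where
  carrier := {r | NegligibleNumber r.1}
  add_mem' := fun ha hb m => (ha m).add (hb m)
  zero_mem' := fun m => isBigO_zero _ _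
  smul_mem' := by
    rintro ⟨c, N, hN⟩ ⟨r, _⟩ hr m
    refine (hN.mul (hr (m + N))).congr_right fun ε => ?_
    have h0 : (ε : ℝ) ≠ 0 := ε.2.1.ne'
    rw [pow_add]
    field_simp

/-- The ring `ℝ̃` of generalized numbers. -/
abbrev GenReal : Type := moderateSubring ⧸ negligibleIdeal

/-- The class in `ℝ̃` of a moderate net. -/
def GenReal.mk (r : Eps → ℝ) (hr : ModerateNumber r) : GenReal :=
  Ideal.Quotient.mk negligibleIdeal ⟨r, hr⟩

lemma GenReal.mk_eq_mk {r s : Eps → ℝ} {hr : ModerateNumber r} {hs : ModerateNumber s} :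
    GenReal.mk r hr = GenReal.mk s hs ↔ NegligibleNumber (r - s) :=
  Ideal.Quotient.eq

/-! ### Compactly supported generalized points of an open subset of a Euclidean space -/

/-- The model space `ℝ^d` with the Euclidean norm. -/
abbrev Euc (d : ℕ) : Type := EuclideanSpace ℝ (Fin d)

/-- Nets of points of `Ω` that stay in a fixed compact subset of `Ω` for small `ε`. -/
def CompactNet {d : ℕ} (Ω : Set (Euc d)) : Type :=
  {z : Eps → Euc d // (∀ ε, z ε ∈ Ω) ∧
    ∃ K : Set (Euc d), IsCompact K ∧ K ⊆ Ω ∧ ∀ᶠ ε in small, z ε ∈ K}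

/-- Two nets of points are equivalent if `|x_ε - y_ε| = O(ε^m)` for all `m`. -/
def compactNetSetoid {d : ℕ} (Ω : Set (Euc d)) : Setoid (CompactNet Ω) where
  r x y := ∀ m : ℕ, (fun ε => x.1 ε - y.1 ε) =O[small] fun ε : Eps => (ε : ℝ) ^ m
  iseqv :=
    { refl := fun x m => by simpa using isBigO_zero _ _
      symm := fun {x y} h m => by simpa using (h m).neg_left
      trans := fun {x y z} h h' m => by simpa using (h m).add (h' m) }

/-- The set `Ω̃_c` of compactly supported generalized points of `Ω`. -/
def GenPoint {d : ℕ} (Ω : Set (Euc d)) : Type := Quotient (compactNetSetoid Ω)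

/-! ### Smooth `(0,2)`-tensor fields -/

section Tensor

variable {d : ℕ} {M : Type*} [TopologicalSpace M]

/-- The image under the chart `e` of the part of the chart domain lying in `U`. -/
def chartImage (e : OpenPartialHomeomorph M (Euc d)) (U : Opens M) : Set (Euc d) :=
  e.target ∩ e.symm ⁻¹' U

lemma isOpen_chartImage (e : OpenPartialHomeomorph M (Euc d)) (U : Opens M) :
    IsOpen (chartImage e U) :=
  e.symm.isOpen_inter_preimage U.isOpen

variable [ChartedSpace (Euc d) M]

variable (d M) in
/-- Bilinear forms on the tangent spaces of `M`, with no regularity in the base point. A tensor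
field on an open set `U` is encoded by such a family; its values outside `U` are irrelevant. -/
abbrev TensorField : Type _ :=
  ∀ x : M, TangentSpace (𝓡 d) x →L[ℝ] TangentSpace (𝓡 d) x →L[ℝ] ℝ

variable (d M) in
/-- The charts of `M` (all charts of the maximal smooth atlas). -/
abbrev charts : Set (OpenPartialHomeomorph M (Euc d)) := IsManifold.maximalAtlas (𝓡 d) ∞ M

/-- The tensor field `s` is smooth on `U`, as a section of the bundle `T⁰₂ M`. -/
def SmoothTensorOn [IsManifold (𝓡 d) ∞ M] (U : Opens M) (s : TensorField d M) : Prop :=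
  ContMDiffOn (𝓡 d) ((𝓡 d).prod 𝓘(ℝ, Euc d →L[ℝ] Euc d →L[ℝ] ℝ)) ∞
    (fun x => Bundle.TotalSpace.mk' (Euc d →L[ℝ] Euc d →L[ℝ] ℝ) x (s x)) U

/-- The tangent vector `∂_i` at `ψ⁻¹ z` of the chart `ψ = e`, i.e. the image of the standard
basis vector `e_i` under the derivative of `ψ⁻¹` at `z`. -/
noncomputable def coordVector (e : OpenPartialHomeomorph M (Euc d)) (i : Fin d) (z : Euc d) :
    TangentSpace (𝓡 d) (e.symm z) :=
  mfderiv 𝓘(ℝ, Euc d) (𝓡 d) e.symm z (EuclideanSpace.single i 1 : Euc d)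

/-- The component `s_ij` of `s = s_ij dx^i ⊗ dx^j` in the chart `ψ = e`, as a function on the
image of the chart. These are the components of the push-forward `ψ_* s` in the standard basis. -/
noncomputable def component (e : OpenPartialHomeomorph M (Euc d)) (s : TensorField d M)
    (i j : Fin d) (z : Euc d) : ℝ :=
  s (e.symm z) (coordVector e i z) (coordVector e j z)

/-- The matrix `(s_ij)` of `s` in the chart `e`. -/
noncomputable def localMatrix (e : OpenPartialHomeomorph M (Euc d)) (s : TensorField d M)
    (z : Euc d) : Matrix (Fin d) (Fin d) ℝ :=
  Matrix.of fun i j => component e s i j z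

/-- The partial derivative in direction `i` of a function on (an open subset of) `ℝ^d`. -/
noncomputable def partialDeriv (i : Fin d) (f : Euc d → ℝ) (z : Euc d) : ℝ :=
  fderiv ℝ f z (EuclideanSpace.single i 1)

/-- The component `(ds)_ijk = ∂_i s_jk - ∂_j s_ik + ∂_k s_ij` in the chart `e` of the exterior
derivative of `s`, used for skew-symmetric `s`. -/
noncomputable def extDerivComponent (e : OpenPartialHomeomorph M (Euc d)) (s : TensorField d M)
    (i j k : Fin d) (z : Euc d) : ℝ :=
  partialDeriv i (component e s j k) z - partialDeriv j (component e s i k) z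
    + partialDeriv k (component e s i j) z

/-- `s` is a `2`-form on `U`: it is skew-symmetric at each point of `U`. -/
def IsSkewOn (U : Opens M) (s : TensorField d M) : Prop :=
  ∀ x ∈ U, ∀ v w : TangentSpace (𝓡 d) x, s x v w = -s x w v

/-- A genuine symplectic form on `U`: a smooth `2`-form that is non-degenerate at each point and
closed, i.e. the exterior derivative of its expression in each chart vanishes. -/
structure IsSymplecticOn [IsManifold (𝓡 d) ∞ M] (U : Opens M) (s : TensorField d M) :
    Prop where
  smooth : SmoothTensorOn U s
  skew : IsSkewOn U s
  nondegenerate : ∀ x ∈ U, ∀ v : TangentSpace (𝓡 d) x, (∀ w, s x v w = 0) → v = 0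
  closed : ∀ e ∈ charts d M, ∀ z ∈ chartImage e U, ∀ i j k, extDerivComponent e s i j k z = 0

/-! ### Generalized `(0,2)`-tensor fields -/

/-- Moderate nets: in each chart, each derivative of the components is `O(ε^{-N})` for some `N`,
uniformly on compact sets. -/
def IsModerate (U : Opens M) (s : Eps → TensorField d M) : Prop :=
  ∀ e ∈ charts d M, ∀ K : Set (Euc d), IsCompact K → K ⊆ chartImage e U →
    ∀ (i j : Fin d) (k : ℕ), ∃ (N : ℕ) (C : ℝ), ∀ᶠ ε in small, ∀ z ∈ K,
      ‖iteratedFDeriv ℝ k (component e (s ε) i j) z‖ ≤ C * ((ε : ℝ) ^ N)⁻¹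

/-- The nets `s` and `t` differ by a negligible net: in each chart, the components of the
difference are `O(ε^m)` for all `m`, uniformly on compact sets. -/
def DifferByNegligible (U : Opens M) (s t : Eps → TensorField d M) : Prop :=
  ∀ e ∈ charts d M, ∀ K : Set (Euc d), IsCompact K → K ⊆ chartImage e U →
    ∀ (i j : Fin d) (m : ℕ), ∃ C : ℝ, ∀ᶠ ε in small, ∀ z ∈ K,
      |component e (s ε) i j z - component e (t ε) i j z| ≤ C * (ε : ℝ) ^ m

/-- The exterior derivatives of the members of the net `s` of `2`-forms are a negligible net of
`3`-forms on `U`. -/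
def HasNegligibleExtDeriv (U : Opens M) (s : Eps → TensorField d M) : Prop :=
  ∀ e ∈ charts d M, ∀ K : Set (Euc d), IsCompact K → K ⊆ chartImage e U →
    ∀ (i j k : Fin d) (m : ℕ), ∃ C : ℝ, ∀ᶠ ε in small, ∀ z ∈ K,
      |extDerivComponent e (s ε) i j k z| ≤ C * (ε : ℝ) ^ m

variable [IsManifold (𝓡 d) ∞ M]

/-- Moderate nets of smooth `(0,2)`-tensor fields on `U`. -/
structure TensorNet (U : Opens M) : Type _ where
  /-- the members of the net -/
  toFun : Eps → TensorField d M
  smooth : ∀ ε, SmoothTensorOn U (toFun ε)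
  moderate : IsModerate U toFun

/-- Two moderate nets represent the same generalized tensor field if their difference is
negligible. -/
def tensorNetSetoid (U : Opens M) : Setoid (TensorNet (d := d) U) where
  r s t := DifferByNegligible U s.toFun t.toFun
  iseqv :=
    { refl := fun s e _ K _ _ i j m => ⟨0, Eventually.of_forall fun ε z _ => by simp⟩
      symm := fun {s t} h e he K hK hKU i j m => by
        obtain ⟨C, hC⟩ := h e he K hK hKU i j m
        refine ⟨C, hC.mono fun ε hε z hz => ?_⟩
        rw [abs_sub_comm]
        exact hε z hz
      trans := fun {s t r} h h' e he K hK hKU i j m => by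
        obtain ⟨C, hC⟩ := h e he K hK hKU i j m
        obtain ⟨C', hC'⟩ := h' e he K hK hKU i j m
        refine ⟨C + C', (hC.and hC').mono fun ε hε z hz => ?_⟩
        rw [add_mul]
        exact (abs_sub_le _ (component e (t.toFun ε) i j z) _).trans
          (add_le_add (hε.1 z hz) (hε.2 z hz)) }

variable (d) in
/-- The space `𝒢⁰₂(U)` of generalized `(0,2)`-tensor fields on the open set `U`; the space
`𝒢⁰₂(M)` is the case `U = ⊤`. -/
def GenTensor (U : Opens M) : Type _ := Quotient (tensorNetSetoid (d := d) U)

/-- The class of a moderate net; `s` is a representative of `σ` iff `GenTensor.mk s = σ`. -/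
def GenTensor.mk {U : Opens M} (s : TensorNet (d := d) U) : GenTensor d U :=
  Quotient.mk (tensorNetSetoid U) s

/-- Restriction of moderate nets to a smaller open set. -/
def TensorNet.restrict {U V : Opens M} (h : V ≤ U) (s : TensorNet (d := d) U) :
    TensorNet (d := d) V where
  toFun := s.toFun
  smooth ε := (s.smooth ε).mono h
  moderate e he K hK hKV := s.moderate e he K hK (hKV.trans fun _ hz => ⟨hz.1, h hz.2⟩)

/-- The restriction `σ|_V` of a generalized tensor field to a smaller open set. -/
def GenTensor.restrict {U V : Opens M} (h : V ≤ U) : GenTensor d U → GenTensor d V :=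
  Quotient.map' (TensorNet.restrict h) fun _ _ hst e he K hK hKV =>
    hst e he K hK (hKV.trans fun _ hz => ⟨hz.1, h hz.2⟩)

/-! ### Point values -/

lemma contDiffOn_component {U : Opens M} {s : TensorField d M} (hs : SmoothTensorOn U s)
    {e : OpenPartialHomeomorph M (Euc d)} (he : e ∈ charts d M) (i j : Fin d) :
    ContDiffOn ℝ ∞ (component e s i j) (chartImage e U) := by
  have hO := isOpen_chartImage e U
  have hsymm : ContMDiffOn 𝓘(ℝ, Euc d) (𝓡 d) ∞ e.symm (chartImage e U) :=
    (contMDiffOn_symm_of_mem_maximalAtlas he).mono Set.inter_subset_left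
  have hvec : ∀ i : Fin d, ContMDiffOn 𝓘(ℝ, Euc d) ((𝓡 d).prod 𝓘(ℝ, Euc d)) ∞
      (fun z => Bundle.TotalSpace.mk' (E := fun x : M => TangentSpace (𝓡 d) x) (Euc d) (e.symm z)
        (coordVector e i z)) (chartImage e U) := by
    intro i
    have h1 := hsymm.contMDiffOn_tangentMapWithin (m := ∞) le_rfl hO.uniqueMDiffOn
    have h2 : ContMDiffOn 𝓘(ℝ, Euc d) (𝓘(ℝ, Euc d).prod 𝓘(ℝ, Euc d)) ∞
        (fun z => Bundle.TotalSpace.mk' (E := fun x : Euc d => TangentSpace 𝓘(ℝ, Euc d) x)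
          (Euc d) z (EuclideanSpace.single i 1 : Euc d)) (chartImage e U) :=
      contMDiffOn_vectorSpace_iff_contDiffOn.2 contDiffOn_const
    refine (h1.comp h2 (fun z hz => hz)).congr fun z hz => ?_
    simp only [Function.comp, tangentMapWithin]
    rw [mfderivWithin_of_isOpen hO hz]
    rfl
  have hbil : ContMDiffOn 𝓘(ℝ, Euc d) ((𝓡 d).prod 𝓘(ℝ, Euc d →L[ℝ] Euc d →L[ℝ] ℝ)) ∞
      (fun z => Bundle.TotalSpace.mk'
        (E := fun x : M => TangentSpace (𝓡 d) x →L[ℝ] TangentSpace (𝓡 d) x →L[ℝ] ℝ)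
        (Euc d →L[ℝ] Euc d →L[ℝ] ℝ) (e.symm z) (s (e.symm z))) (chartImage e U) :=
    ContMDiffOn.comp (g := fun x => Bundle.TotalSpace.mk' (Euc d →L[ℝ] Euc d →L[ℝ] ℝ) x (s x))
      hs hsymm fun z hz => hz.2
  have h := ContMDiffOn.clm_bundle_apply₂ (F₃ := ℝ) (E₃ := Bundle.Trivial M ℝ)
    hbil (hvec i) (hvec j)
  rw [← contMDiffOn_iff_contDiffOn]
  intro z hz
  have := h z hz
  rw [Bundle.contMDiffWithinAt_totalSpace] at this
  exact this.2

lemma isBigO_of_eventually_le {r : Eps → ℝ} {g : Eps → ℝ} (C : ℝ)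
    (h : ∀ᶠ ε in small, |r ε| ≤ C * g ε) (hg : ∀ ε, 0 ≤ g ε) : r =O[small] g :=
  IsBigO.of_bound C (h.mono fun ε hε => by
    rwa [Real.norm_eq_abs, Real.norm_of_nonneg (hg ε)])

lemma moderateNumber_component {U : Opens M} (s : TensorNet (d := d) U)
    {e : OpenPartialHomeomorph M (Euc d)} (he : e ∈ charts d M) (z : CompactNet (chartImage e U))
    (i j : Fin d) : ModerateNumber fun ε => component e (s.toFun ε) i j (z.1 ε) := by
  obtain ⟨K, hK, hKU, hz⟩ := z.2.2
  obtain ⟨N, C, h⟩ := s.moderate e he K hK hKU i j 0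
  refine ⟨N, isBigO_of_eventually_le C ((h.and hz).mono fun ε hε => ?_)
    fun ε => inv_nonneg.2 (pow_nonneg ε.2.1.le _)⟩
  simpa using hε.1 _ hε.2

lemma negligibleNumber_component {U : Opens M} {s t : TensorNet (d := d) U}
    (hst : DifferByNegligible U s.toFun t.toFun)
    {e : OpenPartialHomeomorph M (Euc d)} (he : e ∈ charts d M) (y z : CompactNet (chartImage e U))
    (hyz : compactNetSetoid _ y z) (i j : Fin d) :
    NegligibleNumber ((fun ε => component e (s.toFun ε) i j (y.1 ε)) -
      fun ε => component e (t.toFun ε) i j (z.1 ε)) := by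
  intro m
  obtain ⟨K, hK, hKU, hy⟩ := y.2.2
  obtain ⟨K', hK', hKU', hz⟩ := z.2.2
  have h1 : (fun ε => component e (s.toFun ε) i j (z.1 ε) - component e (t.toFun ε) i j (z.1 ε))
      =O[small] fun ε : Eps => (ε : ℝ) ^ m := by
    obtain ⟨C, h⟩ := hst e he K' hK' hKU' i j m
    exact isBigO_of_eventually_le C ((h.and hz).mono fun ε hε => hε.1 _ hε.2)
      fun ε => pow_nonneg ε.2.1.le _
  have h2 : (fun ε => component e (s.toFun ε) i j (y.1 ε) - component e (s.toFun ε) i j (z.1 ε))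
      =O[small] fun ε : Eps => (ε : ℝ) ^ m := by
    obtain ⟨δ, hδ, hKδ⟩ := hK.exists_cthickening_subset_open (isOpen_chartImage e U) hKU
    obtain ⟨N, C, h⟩ := s.moderate e he _ hK.cthickening hKδ i j 1
    have hlim : Tendsto (fun ε : Eps => (ε : ℝ)) small (𝓝 0) := tendsto_comap
    have hclose : ∀ᶠ ε in small, ‖y.1 ε - z.1 ε‖ < δ := by
      have h0 := ((hyz 1).trans_tendsto (by simpa using hlim)).norm
      rw [norm_zero] at h0
      exact h0.eventually (gt_mem_nhds hδ)
    have hlip : (fun ε => component e (s.toFun ε) i j (y.1 ε) -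
        component e (s.toFun ε) i j (z.1 ε)) =O[small]
        fun ε => ((ε : ℝ) ^ N)⁻¹ * ‖y.1 ε - z.1 ε‖ := by
      refine isBigO_of_eventually_le C ((h.and (hclose.and hy)).mono ?_)
        fun ε => mul_nonneg (inv_nonneg.2 (pow_nonneg ε.2.1.le _)) (norm_nonneg _)
      rintro ε ⟨hb, hc, hyK⟩
      have hball : Metric.closedBall (y.1 ε) ‖y.1 ε - z.1 ε‖ ⊆ Metric.cthickening δ K :=
        (Metric.closedBall_subset_closedBall hc.le).trans
          (Metric.closedBall_subset_cthickening hyK δ)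
      have hdiff : ∀ x ∈ Metric.closedBall (y.1 ε) ‖y.1 ε - z.1 ε‖,
          DifferentiableAt ℝ (component e (s.toFun ε) i j) x := fun x hx =>
        ((contDiffOn_component (s.smooth ε) he i j).contDiffAt
          ((isOpen_chartImage e U).mem_nhds (hKδ (hball hx)))).differentiableAt (by simp)
      have := (convex_closedBall (y.1 ε) ‖y.1 ε - z.1 ε‖).norm_image_sub_le_of_norm_fderiv_le hdiff
        (fun x hx => by
          have := hb x (hball hx)
          rwa [norm_iteratedFDeriv_one] at this)
        (x := z.1 ε) (y := y.1 ε)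
        (by simp [dist_eq_norm, norm_sub_rev]) (Metric.mem_closedBall_self (norm_nonneg _))
      rwa [Real.norm_eq_abs, mul_assoc] at this
    refine hlip.trans (((isBigO_refl _ _).mul (hyz (m + N)).norm_left).congr_right fun ε => ?_)
    have h0 : (ε : ℝ) ≠ 0 := ε.2.1.ne'
    rw [pow_add]
    field_simp
  refine (h2.add h1).congr_left fun ε => ?_
  simp

/-- The matrix in the standard basis of the point value `ψ_* σ (z̃)` of the generalized tensor field
`σ` in the chart `ψ = e`, at the compactly supported generalized point `z̃` of the image of the
chart. Its entries are the generalized numbers `[((σ_ε)_ij (z_ε))_ε]`. -/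
noncomputable def GenTensor.value {U : Opens M} (σ : GenTensor d U)
    (e : OpenPartialHomeomorph M (Euc d)) (he : e ∈ charts d M) (z : GenPoint (chartImage e U)) :
    Matrix (Fin d) (Fin d) GenReal :=
  Matrix.of fun i j =>
    Quotient.liftOn₂ σ z
      (fun s z => GenReal.mk (fun ε => component e (s.toFun ε) i j (z.1 ε))
        (moderateNumber_component s he z i j))
      (fun _ y _ z hst hyz => GenReal.mk_eq_mk.2 (negligibleNumber_component hst he y z hyz i j))

/-! ### Generalized symplectic forms and strict positivity of the volume -/

/-- `σ` is a generalized symplectic form on `M`. First, `σ` is a closed generalized `2`-form: it has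
a representative consisting of smooth `2`-forms whose exterior derivatives are negligible. Second,
for each chart `ψ` and each compactly supported generalized point `z̃` of its image, the
`ℝ̃`-bilinear form `ψ_* σ (z̃)` on `ℝ̃^d` is non-degenerate. -/
structure GenTensor.IsSymplectic (σ : GenTensor d (⊤ : Opens M)) : Prop where
  closed_form : ∃ s : TensorNet (d := d) (⊤ : Opens M), GenTensor.mk s = σ ∧
    (∀ ε, IsSkewOn ⊤ (s.toFun ε)) ∧ HasNegligibleExtDeriv ⊤ s.toFun
  nondegenerate : ∀ (e : OpenPartialHomeomorph M (Euc d)) (he : e ∈ charts d M)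
    (z : GenPoint (chartImage e ⊤)) (v : Fin d → GenReal),
    (∀ w, Matrix.toBilin' (σ.value e he z) v w = 0) → v = 0

/-- The coefficient `√|det (s_ij)|` in the chart `e` of the `1`-density `vol(s)`. -/
noncomputable def volCoeff (e : OpenPartialHomeomorph M (Euc d)) (s : TensorField d M)
    (z : Euc d) : ℝ :=
  √|(localMatrix e s z).det|

/-- `vol(σ)` is strictly positive: for each representative `(σ_ε)`, each chart and each compact
subset `K` of its image there is `m` such that `√|det (σ_ε)_ij| ≥ ε^m` on `K` for small `ε`. -/
def GenTensor.VolStrictlyPositive {U : Opens M} (σ : GenTensor d U) : Prop :=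
  ∀ s : TensorNet (d := d) U, GenTensor.mk s = σ →
    ∀ e ∈ charts d M, ∀ K : Set (Euc d), IsCompact K → K ⊆ chartImage e U →
      ∃ m : ℕ, ∀ᶠ ε : Eps in small, ∀ z ∈ K, (ε : ℝ) ^ m ≤ volCoeff e (s.toFun ε) z

end Tensor

end Colombeau

/-!
The equivalence combines three arguments.

*Volume and non-degeneracy.* At a compactly supported generalized point the determinant of `σ` is
the class of a net of real numbers. If the volume is bounded below by a power of `ε`, this class is
a unit of `ℝ̃`, so the form is non-degenerate (`nondegenerate_of_volStrictlyPositive`). Conversely,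
if the bound fails on a compact set `K`, then `K` contains points `z_ε` at which the matrices of the
representative shrink some unit vector `v_ε` below every power of `ε`, along a sequence `ε_k → 0`;
the `z_ε` form a generalized point, and the `v_ε`, set to zero off the sequence, a non-zero
generalized vector in the kernel (`volStrictlyPositive_of_nondegenerate`).

*Local symplectic representatives.* In a ball of a chart, the Poincaré lemma is applied to each
member `σ_ε` of a representative with negligible exterior derivative. The radial homotopy operator
`H` satisfies `σ_ε = d(H σ_ε) + H(dσ_ε)`, so that `d(H σ_ε)` (here `closedPart`) is closed and
differs from `σ_ε` by the negligible net `H(dσ_ε)`. Derivatives of `H` of a form are radial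
integrals of derivatives, which makes the new net moderate. Since determinants of nets differing by
a negligible net differ by a negligible net, the closed forms are non-degenerate for small `ε` on
the whole ball (`eventually_nondegenerateForm`); for the remaining parameters they are replaced by a
fixed one of them. Being symplectic in one chart, these forms are symplectic in all charts, because
the exterior derivative of a `2`-form commutes with pull-back (`extDerivOf_pullback`).

*A closed representative from local ones.* Take the skew-symmetric part of any representative. Near
each point it differs by a negligible net from a net of closed `2`-forms. A moderate net whose
values are negligible has negligible first derivatives (`ModerateFamily.fderiv_negligible`), so its
exterior derivative is negligible (`exists_closed_representative`).
-/

namespace Colombeau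

open Filter Asymptotics TopologicalSpace

set_option maxSynthPendingDepth 3

/-! ### Uniform estimates for nets of functions -/

section Bounds

variable {X : Type*} {K : Set X} {a b : Eps → X → ℝ}

/-- The real-valued functions `a_ε` are at most `ε^{-N}` on `K` for small `ε`, for some `N`.
A multiplicative constant is not needed because it can be absorbed by increasing `N`. -/
def UniformlyModerateOn (K : Set X) (a : Eps → X → ℝ) : Prop :=
  ∃ N : ℕ, ∀ᶠ ε in small, ∀ z ∈ K, a ε z ≤ ((ε : ℝ) ^ N)⁻¹

/-- The real-valued functions `a_ε` are at most `ε^m` on `K` for small `ε`, for all `m`. -/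
def UniformlyNegligibleOn (K : Set X) (a : Eps → X → ℝ) : Prop :=
  ∀ m : ℕ, ∀ᶠ ε : Eps in small, ∀ z ∈ K, a ε z ≤ (ε : ℝ) ^ m

lemma Eps.pow_le_pow (ε : Eps) {m n : ℕ} (h : m ≤ n) : (ε : ℝ) ^ n ≤ (ε : ℝ) ^ m :=
  pow_le_pow_of_le_one ε.2.1.le ε.2.2 h

lemma Eps.inv_pow_le_inv_pow (ε : Eps) {m n : ℕ} (h : m ≤ n) :
    ((ε : ℝ) ^ m)⁻¹ ≤ ((ε : ℝ) ^ n)⁻¹ :=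
  inv_anti₀ (pow_pos ε.2.1 _) (ε.pow_le_pow h)

lemma eventually_mul_le_one (C : ℝ) : ∀ᶠ ε : Eps in small, C * (ε : ℝ) ≤ 1 := by
  have h : Tendsto (fun ε : Eps => C * (ε : ℝ)) small (𝓝 (C * 0)) :=
    tendsto_comap.const_mul C
  rw [mul_zero] at h
  exact (h.eventually (gt_mem_nhds one_pos)).mono fun _ h => h.le

instance small_neBot : small.NeBot := by
  refine ⟨fun h => ?_⟩
  have h0 : ∀ᶠ _ in small, False := by simp [h]
  obtain ⟨η, hη, h⟩ := eventually_small.1 h0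
  exact h ⟨min (η / 2) 1, lt_min (by positivity) one_pos, min_le_right _ _⟩
    (lt_of_le_of_lt (min_le_left _ _) (by simp; linarith))

lemma uniformlyModerateOn_of_bound {N : ℕ} {C : ℝ}
    (h : ∀ᶠ ε in small, ∀ z ∈ K, a ε z ≤ C * ((ε : ℝ) ^ N)⁻¹) : UniformlyModerateOn K a := by
  refine ⟨N + 1, (h.and (eventually_mul_le_one C)).mono fun ε hε z hz => (hε.1 z hz).trans ?_⟩
  have h0 : (0 : ℝ) < ε := ε.2.1
  rw [pow_succ, mul_inv, mul_comm C]
  gcongr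
  rw [← one_div, le_div_iff₀ h0]
  exact hε.2

lemma UniformlyModerateOn.exists_bound (h : UniformlyModerateOn K a) :
    ∃ (N : ℕ) (C : ℝ), ∀ᶠ ε in small, ∀ z ∈ K, a ε z ≤ C * ((ε : ℝ) ^ N)⁻¹ := by
  obtain ⟨N, h⟩ := h
  exact ⟨N, 1, by simpa using h⟩

lemma uniformlyNegligibleOn_of_bound
    (h : ∀ m : ℕ, ∃ C : ℝ, ∀ᶠ ε : Eps in small, ∀ z ∈ K, a ε z ≤ C * (ε : ℝ) ^ m) :
    UniformlyNegligibleOn K a := by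
  intro m
  obtain ⟨C, h⟩ := h (m + 1)
  refine (h.and (eventually_mul_le_one C)).mono fun ε hε z hz => (hε.1 z hz).trans ?_
  have h0 : (0 : ℝ) < ε := ε.2.1
  calc C * (ε : ℝ) ^ (m + 1) = (C * ε) * (ε : ℝ) ^ m := by ring
    _ ≤ 1 * (ε : ℝ) ^ m := by gcongr; exact hε.2
    _ = _ := one_mul _

lemma UniformlyNegligibleOn.exists_bound (h : UniformlyNegligibleOn K a) (m : ℕ) :
    ∃ C : ℝ, ∀ᶠ ε : Eps in small, ∀ z ∈ K, a ε z ≤ C * (ε : ℝ) ^ m :=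
  ⟨1, by simpa using h m⟩

lemma UniformlyModerateOn.mono_fun (h : UniformlyModerateOn K a)
    (hab : ∀ ε, ∀ z ∈ K, b ε z ≤ a ε z) : UniformlyModerateOn K b := by
  obtain ⟨N, h⟩ := h
  exact ⟨N, h.mono fun ε hε z hz => (hab ε z hz).trans (hε z hz)⟩

lemma UniformlyNegligibleOn.mono_fun (h : UniformlyNegligibleOn K a)
    (hab : ∀ ε, ∀ z ∈ K, b ε z ≤ a ε z) : UniformlyNegligibleOn K b :=
  fun m => (h m).mono fun ε hε z hz => (hab ε z hz).trans (hε z hz)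

lemma UniformlyNegligibleOn.mono {L : Set X} (h : UniformlyNegligibleOn K a) (hL : L ⊆ K) :
    UniformlyNegligibleOn L a :=
  fun m => (h m).mono fun _ hε z hz => hε z (hL hz)

lemma UniformlyModerateOn.comp {Y : Type*} {L : Set Y} (h : UniformlyModerateOn K a) {τ : Y → X}
    (hτ : Set.MapsTo τ L K) : UniformlyModerateOn L fun ε z => a ε (τ z) := by
  obtain ⟨N, h⟩ := h
  exact ⟨N, h.mono fun _ hε _ hz => hε _ (hτ hz)⟩

lemma UniformlyNegligibleOn.comp {Y : Type*} {L : Set Y} (h : UniformlyNegligibleOn K a)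
    {τ : Y → X} (hτ : Set.MapsTo τ L K) : UniformlyNegligibleOn L fun ε z => a ε (τ z) :=
  fun m => (h m).mono fun _ hε _ hz => hε _ (hτ hz)

lemma uniformlyModerateOn_const (C : ℝ) : UniformlyModerateOn K fun _ _ => C :=
  uniformlyModerateOn_of_bound (N := 0) (C := C) (by simp)

lemma UniformlyModerateOn.add (ha : UniformlyModerateOn K a) (hb : UniformlyModerateOn K b) :
    UniformlyModerateOn K fun ε z => a ε z + b ε z := by
  obtain ⟨N, ha⟩ := ha
  obtain ⟨N', hb⟩ := hb
  refine uniformlyModerateOn_of_bound (N := max N N') (C := 2)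
    ((ha.and hb).mono fun ε hε z hz => ?_)
  have h1 := (hε.1 z hz).trans (ε.inv_pow_le_inv_pow (le_max_left N N'))
  have h2 := (hε.2 z hz).trans (ε.inv_pow_le_inv_pow (le_max_right N N'))
  linarith

lemma UniformlyModerateOn.mul (ha : UniformlyModerateOn K a) (hb : UniformlyModerateOn K b)
    (hb0 : ∀ ε, ∀ z ∈ K, 0 ≤ b ε z) :
    UniformlyModerateOn K fun ε z => a ε z * b ε z := by
  obtain ⟨N, ha⟩ := ha
  obtain ⟨N', hb⟩ := hb
  refine ⟨N + N', (ha.and hb).mono fun ε hε z hz => ?_⟩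
  rw [pow_add, mul_inv]
  exact mul_le_mul (hε.1 z hz) (hε.2 z hz) (hb0 ε z hz) (inv_nonneg.2 (pow_nonneg ε.2.1.le _))

lemma UniformlyModerateOn.pow (ha : UniformlyModerateOn K a) (ha0 : ∀ ε, ∀ z ∈ K, 0 ≤ a ε z)
    (n : ℕ) : UniformlyModerateOn K fun ε z => a ε z ^ n := by
  induction n with
  | zero => simpa using uniformlyModerateOn_const 1
  | succ n ih => simpa only [pow_succ] using ih.mul ha ha0

lemma UniformlyModerateOn.sum {ι : Type*} (s : Finset ι) {a : ι → Eps → X → ℝ}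
    (h : ∀ i ∈ s, UniformlyModerateOn K (a i)) :
    UniformlyModerateOn K fun ε z => ∑ i ∈ s, a i ε z := by
  classical
  induction s using Finset.induction_on with
  | empty => simpa using uniformlyModerateOn_const 0
  | insert i s hi ih =>
    simp only [Finset.sum_insert hi]
    exact (h i (by simp)).add (ih fun j hj => h j (by simp [hj]))

lemma UniformlyNegligibleOn.add (ha : UniformlyNegligibleOn K a)
    (hb : UniformlyNegligibleOn K b) : UniformlyNegligibleOn K fun ε z => a ε z + b ε z :=
  uniformlyNegligibleOn_of_bound fun m => ⟨2, ((ha m).and (hb m)).mono fun ε hε z hz => by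
    linarith [hε.1 z hz, hε.2 z hz]⟩

lemma UniformlyNegligibleOn.mul_moderate (ha : UniformlyNegligibleOn K a)
    (hb : UniformlyModerateOn K b) (hb0 : ∀ ε, ∀ z ∈ K, 0 ≤ b ε z) :
    UniformlyNegligibleOn K fun ε z => a ε z * b ε z := by
  obtain ⟨N, hb⟩ := hb
  intro m
  refine ((ha (m + N)).and hb).mono fun ε hε z hz => ?_
  have h0 : (0 : ℝ) < ε := ε.2.1
  calc a ε z * b ε z ≤ (ε : ℝ) ^ (m + N) * ((ε : ℝ) ^ N)⁻¹ :=
        mul_le_mul (hε.1 z hz) (hε.2 z hz) (hb0 ε z hz) (pow_nonneg h0.le _)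
    _ = (ε : ℝ) ^ m := by rw [pow_add]; field_simp

lemma UniformlyNegligibleOn.sum {ι : Type*} (s : Finset ι) {a : ι → Eps → X → ℝ}
    (h : ∀ i ∈ s, UniformlyNegligibleOn K (a i)) :
    UniformlyNegligibleOn K fun ε z => ∑ i ∈ s, a i ε z := by
  classical
  induction s using Finset.induction_on with
  | empty =>
    intro m
    exact Eventually.of_forall fun ε z _ => by simpa using pow_nonneg ε.2.1.le m
  | insert i s hi ih =>
    simp only [Finset.sum_insert hi]
    exact (h i (by simp)).add (ih fun j hj => h j (by simp [hj]))

lemma uniformlyModerateOn_of_continuousOn {X : Type*} [TopologicalSpace X] {K : Set X}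
    (hK : IsCompact K) {f : X → ℝ} (hf : ContinuousOn f K) :
    UniformlyModerateOn K fun _ => f := by
  obtain ⟨C, hC⟩ := hK.bddAbove_image hf
  exact (uniformlyModerateOn_const C).mono_fun fun _ z hz => hC (Set.mem_image_of_mem f hz)

/-- Uniform negligibility on a compact set is a local property. -/
lemma uniformlyNegligibleOn_of_forall_mem_nhds {X : Type*} [TopologicalSpace X] {K : Set X}
    (hK : IsCompact K) {a : Eps → X → ℝ}
    (h : ∀ z ∈ K, ∃ L ∈ 𝓝 z, UniformlyNegligibleOn L a) : UniformlyNegligibleOn K a := by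
  refine hK.induction_on (p := fun K => UniformlyNegligibleOn K a) ?_ ?_ ?_ ?_
  · exact fun m => Eventually.of_forall fun _ _ hz => hz.elim
  · exact fun s t hst ht => ht.mono hst
  · exact fun s t hs ht m => ((hs m).and (ht m)).mono fun ε hε z hz =>
      hz.elim (hε.1 z) (hε.2 z)
  · intro z hz
    obtain ⟨L, hL, h⟩ := h z hz
    exact ⟨L, mem_nhdsWithin_of_mem_nhds hL, h⟩

end Bounds

/-! ### Moderate families of smooth maps -/

section ModerateFamily

variable {E F G H : Type*} [NormedAddCommGroup E] [NormedSpace ℝ E] [NormedAddCommGroup F]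
  [NormedSpace ℝ F] [NormedAddCommGroup G] [NormedSpace ℝ G] [NormedAddCommGroup H]
  [NormedSpace ℝ H]

/-- A moderate net of smooth maps on `Ω`: all derivatives are `O(ε^{-N})` for some `N`, uniformly
on compact subsets of `Ω`. -/
structure ModerateFamily (Ω : Set E) (f : Eps → E → F) : Prop where
  smooth : ∀ ε, ContDiffOn ℝ ∞ (f ε) Ω
  bound : ∀ K : Set E, IsCompact K → K ⊆ Ω → ∀ k : ℕ,
    UniformlyModerateOn K fun ε z => ‖iteratedFDeriv ℝ k (f ε) z‖

variable {Ω : Set E} {f : Eps → E → F}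

lemma continuousOn_norm_iteratedFDeriv (hΩ : IsOpen Ω) {f : E → F} (hf : ContDiffOn ℝ ∞ f Ω)
    (k : ℕ) : ContinuousOn (fun z => ‖iteratedFDeriv ℝ k f z‖) Ω :=
  ((hf.continuousOn_iteratedFDerivWithin (m := k) (by exact_mod_cast le_top)
    hΩ.uniqueDiffOn).congr fun z hz => (iteratedFDerivWithin_of_isOpen k hΩ hz).symm).norm

lemma moderateFamily_const (hΩ : IsOpen Ω) {f : E → F} (hf : ContDiffOn ℝ ∞ f Ω) :
    ModerateFamily Ω fun _ => f where
  smooth _ := hf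
  bound _ hK hKΩ k := uniformlyModerateOn_of_continuousOn hK
    ((continuousOn_norm_iteratedFDeriv hΩ hf k).mono hKΩ)

lemma ModerateFamily.mono (hf : ModerateFamily Ω f) {Ω' : Set E} (h : Ω' ⊆ Ω) :
    ModerateFamily Ω' f where
  smooth ε := (hf.smooth ε).mono h
  bound K hK hKΩ := hf.bound K hK (hKΩ.trans h)

lemma ModerateFamily.congr (hΩ : IsOpen Ω) (hf : ModerateFamily Ω f) {g : Eps → E → F}
    (h : ∀ ε, Set.EqOn (g ε) (f ε) Ω) : ModerateFamily Ω g where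
  smooth ε := (hf.smooth ε).congr (h ε)
  bound K hK hKΩ k := (hf.bound K hK hKΩ k).mono_fun fun ε z hz => by
    rw [((h ε).eventuallyEq_of_mem (hΩ.mem_nhds (hKΩ hz))).iteratedFDeriv ℝ k |>.eq_of_nhds]

lemma ModerateFamily.bilinear (hΩ : IsOpen Ω) (B : F →L[ℝ] G →L[ℝ] H) (hf : ModerateFamily Ω f)
    {g : Eps → E → G} (hg : ModerateFamily Ω g) :
    ModerateFamily Ω fun ε z => B (f ε z) (g ε z) where
  smooth ε := B.isBoundedBilinearMap.contDiff.comp₂_contDiffOn (hf.smooth ε) (hg.smooth ε)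
  bound K hK hKΩ k := by
    have h : UniformlyModerateOn K fun ε z => ‖B‖ * ∑ i ∈ Finset.range (k + 1),
        (k.choose i : ℝ) * ‖iteratedFDeriv ℝ i (f ε) z‖ * ‖iteratedFDeriv ℝ (k - i) (g ε) z‖ := by
      refine (uniformlyModerateOn_const ‖B‖).mul (UniformlyModerateOn.sum _ fun i _ =>
        ((uniformlyModerateOn_const _).mul (hf.bound K hK hKΩ i) ?_).mul
          (hg.bound K hK hKΩ (k - i)) ?_) ?_
      all_goals intros; positivity
    refine h.mono_fun fun ε z hz => ?_
    have := B.norm_iteratedFDerivWithin_le_of_bilinear (hf.smooth ε) (hg.smooth ε)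
      hΩ.uniqueDiffOn (hKΩ hz) (n := k) (by exact_mod_cast le_top)
    simpa only [iteratedFDerivWithin_of_isOpen _ hΩ (hKΩ hz)] using this

lemma ModerateFamily.clm_comp (hΩ : IsOpen Ω) (L : F →L[ℝ] G) (hf : ModerateFamily Ω f) :
    ModerateFamily Ω fun ε z => L (f ε z) :=
  (moderateFamily_const hΩ (contDiffOn_const (c := L))).bilinear hΩ
    (ContinuousLinearMap.id ℝ (F →L[ℝ] G)) hf

lemma ModerateFamily.add (hΩ : IsOpen Ω) (hf : ModerateFamily Ω f) {g : Eps → E → F}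
    (hg : ModerateFamily Ω g) : ModerateFamily Ω fun ε z => f ε z + g ε z where
  smooth ε := (hf.smooth ε).add (hg.smooth ε)
  bound K hK hKΩ k := by
    refine ((hf.bound K hK hKΩ k).add (hg.bound K hK hKΩ k)).mono_fun fun ε z hz => ?_
    have h1 := ((hf.smooth ε).contDiffAt (hΩ.mem_nhds (hKΩ hz))).of_le
      (show ((k : ℕ) : WithTop ℕ∞) ≤ ∞ by exact_mod_cast le_top)
    have h2 := ((hg.smooth ε).contDiffAt (hΩ.mem_nhds (hKΩ hz))).of_le
      (show ((k : ℕ) : WithTop ℕ∞) ≤ ∞ by exact_mod_cast le_top)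
    rw [fun_iteratedFDeriv_add_apply h1 h2]
    exact norm_add_le _ _

lemma ModerateFamily.sub (hΩ : IsOpen Ω) (hf : ModerateFamily Ω f) {g : Eps → E → F}
    (hg : ModerateFamily Ω g) : ModerateFamily Ω fun ε z => f ε z - g ε z := by
  simpa [sub_eq_add_neg] using
    hf.add hΩ (hg.clm_comp hΩ (-ContinuousLinearMap.id ℝ F))

lemma ModerateFamily.sum (hΩ : IsOpen Ω) {ι : Type*} (s : Finset ι) {f : ι → Eps → E → F}
    (hf : ∀ i ∈ s, ModerateFamily Ω (f i)) : ModerateFamily Ω fun ε z => ∑ i ∈ s, f i ε z := by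
  classical
  induction s using Finset.induction_on with
  | empty => simpa using moderateFamily_const hΩ contDiffOn_const
  | insert i s hi ih =>
    simp only [Finset.sum_insert hi]
    exact (hf i (by simp)).add hΩ (ih fun j hj => hf j (by simp [hj]))

lemma ModerateFamily.fderiv (hΩ : IsOpen Ω) (hf : ModerateFamily Ω f) :
    ModerateFamily Ω fun ε => fderiv ℝ (f ε) where
  smooth ε := (hf.smooth ε).fderiv_of_isOpen hΩ (by simp)
  bound K hK hKΩ k := (hf.bound K hK hKΩ (k + 1)).mono_fun fun ε z _ => by
    rw [norm_iteratedFDeriv_fderiv]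

lemma ModerateFamily.comp (hΩ : IsOpen Ω) (hf : ModerateFamily Ω f) {Ω' : Set G}
    (hΩ' : IsOpen Ω') {τ : G → E} (hτ : ContDiffOn ℝ ∞ τ Ω') (hmaps : Set.MapsTo τ Ω' Ω) :
    ModerateFamily Ω' fun ε z => f ε (τ z) where
  smooth ε := (hf.smooth ε).comp hτ hmaps
  bound K hK hKΩ k := by
    have hτK : IsCompact (τ '' K) := hK.image_of_continuousOn (hτ.continuousOn.mono hKΩ)
    have hτKΩ : τ '' K ⊆ Ω := (hmaps.mono_left hKΩ).image_subset
    have h : UniformlyModerateOn K fun ε z => ((k.factorial : ℝ) * ∑ i ∈ Finset.range (k + 1),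
        ‖iteratedFDeriv ℝ i (f ε) (τ z)‖) *
          (1 + ∑ i ∈ Finset.range (k + 1), ‖iteratedFDeriv ℝ i τ z‖) ^ k := by
      refine ((uniformlyModerateOn_const _).mul (UniformlyModerateOn.sum _ fun i _ =>
        (hf.bound _ hτK hτKΩ i).comp (Set.mapsTo_image τ K)) ?_).mul
        (((uniformlyModerateOn_const 1).add (UniformlyModerateOn.sum _ fun i _ =>
          uniformlyModerateOn_of_continuousOn hK
            ((continuousOn_norm_iteratedFDeriv hΩ' hτ i).mono hKΩ))).pow ?_ k) ?_
      all_goals intros; positivity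
    refine h.mono_fun fun ε z hz => ?_
    have := norm_iteratedFDerivWithin_comp_le (hf.smooth ε) hτ (n := k)
      (by exact_mod_cast le_top) hΩ.uniqueDiffOn hΩ'.uniqueDiffOn hmaps (hKΩ hz)
      (C := ∑ i ∈ Finset.range (k + 1), ‖iteratedFDeriv ℝ i (f ε) (τ z)‖)
      (D := 1 + ∑ i ∈ Finset.range (k + 1), ‖iteratedFDeriv ℝ i τ z‖) ?_ ?_
    · rwa [iteratedFDerivWithin_of_isOpen _ hΩ' (hKΩ hz)] at this
    · intro i hi
      rw [iteratedFDerivWithin_of_isOpen _ hΩ (hmaps (hKΩ hz))]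
      exact Finset.single_le_sum (f := fun i => ‖iteratedFDeriv ℝ i (f ε) (τ z)‖)
        (fun _ _ => norm_nonneg _) (Finset.mem_range.2 (by omega))
    · intro i hi1 hi
      rw [iteratedFDerivWithin_of_isOpen _ hΩ' (hKΩ hz)]
      have h1 := Finset.single_le_sum (f := fun i => ‖iteratedFDeriv ℝ i τ z‖)
        (fun _ _ => norm_nonneg _) (Finset.mem_range.2 (show i < k + 1 by omega))
      have h0 : 0 ≤ ∑ i ∈ Finset.range (k + 1), ‖iteratedFDeriv ℝ i τ z‖ :=
        Finset.sum_nonneg fun _ _ => norm_nonneg _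
      refine le_trans ?_ (le_self_pow₀ (by linarith) (by omega))
      linarith

/-- For a moderate family, negligibility of the values on compact sets implies negligibility of
the first derivatives: `f(z + hv) - f(z) = h f'(z)v + O(h² ε^{-N})`, and `h` may be chosen to be a
large power of `ε`. -/
lemma ModerateFamily.fderiv_negligible [ProperSpace E] (hΩ : IsOpen Ω) (hf : ModerateFamily Ω f)
    (h0 : ∀ K : Set E, IsCompact K → K ⊆ Ω → UniformlyNegligibleOn K fun ε z => ‖f ε z‖)
    {K : Set E} (hK : IsCompact K) (hKΩ : K ⊆ Ω) :
    UniformlyNegligibleOn K fun ε z => ‖_root_.fderiv ℝ (f ε) z‖ := by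
  obtain ⟨δ, hδ, hKδ⟩ := hK.exists_cthickening_subset_open hΩ hKΩ
  obtain ⟨N, hN⟩ := (hf.fderiv hΩ).bound _ hK.cthickening hKδ 1
  have hneg := h0 _ hK.cthickening hKδ
  intro m
  refine (hN.and ((hneg (2 * (N + m + 1))).and ((eventually_mul_le_one 3).and
    (eventually_mul_le_one δ⁻¹)))).mono ?_
  rintro ε ⟨h2, h1, h3, hεδ⟩ z hz
  have hε : (0 : ℝ) < ε := ε.2.1
  set h : ℝ := (ε : ℝ) ^ (N + m + 1) with hh
  have hpos : 0 < h := by positivity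
  have hle : h ≤ δ := by
    calc h ≤ (ε : ℝ) ^ 1 := ε.pow_le_pow (by omega)
      _ = ε := pow_one _
      _ ≤ δ := by rwa [inv_mul_le_iff₀ hδ, mul_one] at hεδ
  have hball : Metric.closedBall z h ⊆ Metric.cthickening δ K :=
    (Metric.closedBall_subset_closedBall hle).trans (Metric.closedBall_subset_cthickening hz δ)
  have hdiff : ∀ x ∈ Metric.closedBall z h, DifferentiableAt ℝ (f ε) x := fun x hx =>
    ((hf.smooth ε).contDiffAt (hΩ.mem_nhds (hKδ (hball hx)))).differentiableAt (by simp)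
  have hdiff2 : ∀ x ∈ Metric.closedBall z h, DifferentiableAt ℝ (_root_.fderiv ℝ (f ε)) x :=
    fun x hx => (((hf.fderiv hΩ).smooth ε).contDiffAt
      (hΩ.mem_nhds (hKδ (hball hx)))).differentiableAt (by simp)
  have hzb : z ∈ Metric.closedBall z h := Metric.mem_closedBall_self hpos.le
  have hlip : ∀ x ∈ Metric.closedBall z h,
      ‖_root_.fderiv ℝ (f ε) x - _root_.fderiv ℝ (f ε) z‖ ≤ ((ε : ℝ) ^ N)⁻¹ * h := by
    intro x hx
    have := (convex_closedBall z h).norm_image_sub_le_of_norm_fderiv_le hdiff2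
      (C := ((ε : ℝ) ^ N)⁻¹)
      (fun y hy => by simpa only [norm_iteratedFDeriv_one] using h2 y (hball hy)) hzb hx
    refine this.trans (by gcongr; simpa [dist_eq_norm] using hx)
  refine ContinuousLinearMap.opNorm_le_of_unit_norm (by positivity) fun v hv => ?_
  have hzv : z + h • v ∈ Metric.closedBall z h := by
    simp [norm_smul, hv, abs_of_pos hpos]
  have key := (convex_closedBall z h).norm_image_sub_le_of_norm_fderiv_le' hdiff hlip hzb hzv
  have hnorm : ‖z + h • v - z‖ = h := by simp [norm_smul, hv, abs_of_pos hpos]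
  rw [hnorm] at key
  have e1 := h1 _ (hball hzv)
  have e2 := h1 _ (hball hzb)
  have key2 : h * ‖_root_.fderiv ℝ (f ε) z v‖ ≤
      (ε : ℝ) ^ (2 * (N + m + 1)) + (ε : ℝ) ^ (2 * (N + m + 1)) + ((ε : ℝ) ^ N)⁻¹ * h * h := by
    have : h * ‖_root_.fderiv ℝ (f ε) z v‖ = ‖_root_.fderiv ℝ (f ε) z (z + h • v - z)‖ := by
      simp [norm_smul, abs_of_pos hpos]
    rw [this]
    calc ‖_root_.fderiv ℝ (f ε) z (z + h • v - z)‖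
        = ‖f ε (z + h • v) - f ε z - (f ε (z + h • v) - f ε z -
            _root_.fderiv ℝ (f ε) z (z + h • v - z))‖ := by congr 1; abel
      _ ≤ _ := (norm_sub_le _ _).trans (add_le_add ((norm_sub_le _ _).trans (add_le_add e1 e2)) key)
  have e3 : (ε : ℝ) ^ (2 * (N + m + 1)) = h * h := by rw [hh, ← pow_add]; ring_nf
  have e4 : ((ε : ℝ) ^ N)⁻¹ * h = (ε : ℝ) ^ (m + 1) := by
    rw [hh, show N + m + 1 = N + (m + 1) by ring, pow_add]
    field_simp
  have e5 : h ≤ (ε : ℝ) ^ (m + 1) := ε.pow_le_pow (by omega)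
  rw [e3, e4] at key2
  have key3 : ‖_root_.fderiv ℝ (f ε) z v‖ ≤ h + h + (ε : ℝ) ^ (m + 1) := by
    refine le_of_mul_le_mul_left (key2.trans (le_of_eq (by ring))) hpos
  calc ‖_root_.fderiv ℝ (f ε) z v‖ ≤ (3 * ε) * (ε : ℝ) ^ m := by
        rw [pow_succ] at e5 key3; linarith
    _ ≤ 1 * (ε : ℝ) ^ m := by gcongr
    _ = _ := one_mul _

end ModerateFamily

/-! ### The radial homotopy operator and the Poincaré lemma on a ball -/

section Homotopy

lemma exists_closedBall_of_isCompact_subset_ball {E : Type*} [NormedAddCommGroup E] {x₀ : E}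
    {r : ℝ} {K : Set E} (hK : IsCompact K)
    (hKr : K ⊆ Metric.ball x₀ r) : ∃ ρ < r, ∀ x ∈ K, ‖x - x₀‖ ≤ ρ := by
  rcases K.eq_empty_or_nonempty with rfl | hne
  · exact ⟨r - 1, by linarith, by simp⟩
  · obtain ⟨y, hy, h⟩ := hK.exists_isMaxOn hne
      (f := fun x => ‖x - x₀‖) (by fun_prop)
    exact ⟨‖y - x₀‖, by simpa [dist_eq_norm] using hKr hy, h⟩

variable {E F : Type} [NormedAddCommGroup E] [NormedSpace ℝ E] [NormedAddCommGroup F]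
  [NormedSpace ℝ F]

/-- The weighted average `∫₀¹ tⁿ f(x₀ + t(x - x₀)) dt` of `f` along the segment from `x₀` to `x`. -/
noncomputable def radialIntegral (x₀ : E) (n : ℕ) (f : E → F) (x : E) : F :=
  ∫ t in (0 : ℝ)..1, t ^ n • f (x₀ + t • (x - x₀))

variable {x₀ : E} {r : ℝ}

lemma radial_mem_closedBall (x : E) {t : ℝ} (ht : t ∈ Set.Icc (0 : ℝ) 1) :
    x₀ + t • (x - x₀) ∈ Metric.closedBall x₀ ‖x - x₀‖ := by
  rw [mem_closedBall_iff_norm, add_sub_cancel_left, norm_smul, Real.norm_of_nonneg ht.1]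
  exact mul_le_of_le_one_left (norm_nonneg _) ht.2

lemma radial_mem_ball {x : E} (hx : x ∈ Metric.ball x₀ r) {t : ℝ} (ht : t ∈ Set.Icc (0 : ℝ) 1) :
    x₀ + t • (x - x₀) ∈ Metric.ball x₀ r :=
  Metric.closedBall_subset_ball (by simpa [dist_eq_norm] using hx) (radial_mem_closedBall x ht)

lemma continuousOn_radial {f : E → F} (hf : ContinuousOn f (Metric.ball x₀ r)) {x : E}
    (hx : x ∈ Metric.ball x₀ r) (n : ℕ) :
    ContinuousOn (fun t : ℝ => t ^ n • f (x₀ + t • (x - x₀))) (Set.uIcc 0 1) := by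
  rw [Set.uIcc_of_le zero_le_one]
  refine (continuousOn_pow n).smul (hf.comp (by fun_prop) fun t ht => radial_mem_ball hx ht)

lemma intervalIntegrable_radial {f : E → F} (hf : ContinuousOn f (Metric.ball x₀ r)) {x : E}
    (hx : x ∈ Metric.ball x₀ r) (n : ℕ) :
    IntervalIntegrable (fun t : ℝ => t ^ n • f (x₀ + t • (x - x₀))) MeasureTheory.volume 0 1 :=
  (continuousOn_radial hf hx n).intervalIntegrable

lemma norm_radialIntegral_le {f : E → F} {x : E} {C : ℝ}
    (hC : ∀ y ∈ Metric.closedBall x₀ ‖x - x₀‖, ‖f y‖ ≤ C) (n : ℕ) :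
    ‖radialIntegral x₀ n f x‖ ≤ C := by
  have h := intervalIntegral.norm_integral_le_of_norm_le_const (a := (0 : ℝ)) (b := 1) (C := C)
    (f := fun t : ℝ => t ^ n • f (x₀ + t • (x - x₀))) fun t ht => by
      rw [Set.uIoc_of_le zero_le_one] at ht
      have h1 := hC _ (radial_mem_closedBall x ⟨ht.1.le, ht.2⟩)
      rw [norm_smul, norm_pow, Real.norm_of_nonneg ht.1.le]
      exact (mul_le_of_le_one_left (norm_nonneg _) (pow_le_one₀ ht.1.le ht.2)).trans h1
  simpa [radialIntegral] using h

lemma hasFDerivAt_radialIntegral [ProperSpace E] [CompleteSpace F] {f : E → F}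
    (hf : ContDiffOn ℝ ∞ f (Metric.ball x₀ r)) {x : E} (hx : x ∈ Metric.ball x₀ r) (n : ℕ) :
    HasFDerivAt (radialIntegral x₀ n f) (radialIntegral x₀ (n + 1) (fderiv ℝ f) x) x := by
  have hxr : ‖x - x₀‖ < r := by simpa [dist_eq_norm] using hx
  obtain ⟨ρ, hρ, hρr⟩ := exists_between hxr
  have hf' : ContDiffOn ℝ ∞ (fderiv ℝ f) (Metric.ball x₀ r) :=
    hf.fderiv_of_isOpen Metric.isOpen_ball (by simp)
  have hsub : Metric.closedBall x₀ ρ ⊆ Metric.ball x₀ r := Metric.closedBall_subset_ball hρr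
  obtain ⟨C, hC⟩ := (isCompact_closedBall x₀ ρ).exists_bound_of_continuousOn
    (hf'.continuousOn.mono hsub)
  have hxρ : x ∈ Metric.ball x₀ ρ := by simpa [dist_eq_norm] using hρ
  have hball : ∀ y ∈ Metric.ball x₀ ρ, y ∈ Metric.ball x₀ r := fun y hy =>
    Metric.ball_subset_ball hρr.le hy
  have hmeas : ∀ {G : Type} [NormedAddCommGroup G] [NormedSpace ℝ G] (g : E → G) (k : ℕ),
      ContinuousOn g (Metric.ball x₀ r) → ∀ y ∈ Metric.ball x₀ ρ,
      MeasureTheory.AEStronglyMeasurable (fun t : ℝ => t ^ k • g (x₀ + t • (y - x₀)))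
        (MeasureTheory.volume.restrict (Set.uIoc 0 1)) := fun g k hg y hy =>
    ((continuousOn_radial hg (hball y hy) k).mono Set.uIoc_subset_uIcc).aestronglyMeasurable
      measurableSet_uIoc
  refine intervalIntegral.hasFDerivAt_integral_of_dominated_of_fderiv_le (bound := fun _ => C)
    (Metric.isOpen_ball.mem_nhds hxρ)
    (F' := fun y t => t ^ (n + 1) • fderiv ℝ f (x₀ + t • (y - x₀)))
    ?_ (intervalIntegrable_radial hf.continuousOn hx n)
    (hmeas _ (n + 1) hf'.continuousOn x hxρ) ?_ (by simp) ?_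
  · filter_upwards [Metric.isOpen_ball.mem_nhds hxρ] with y hy
    exact hmeas f n hf.continuousOn y hy
  · refine Eventually.of_forall fun t ht y hy => ?_
    rw [Set.uIoc_of_le zero_le_one] at ht
    rw [norm_smul, norm_pow, Real.norm_of_nonneg ht.1.le]
    refine (mul_le_of_le_one_left (norm_nonneg _) (pow_le_one₀ ht.1.le ht.2)).trans (hC _ ?_)
    exact Metric.ball_subset_closedBall (radial_mem_ball hy ⟨ht.1.le, ht.2⟩)
  · refine Eventually.of_forall fun t ht y hy => ?_
    rw [Set.uIoc_of_le zero_le_one] at ht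
    have h1 : HasFDerivAt f (fderiv ℝ f (x₀ + t • (y - x₀))) (x₀ + t • (y - x₀)) :=
      ((hf.contDiffAt (Metric.isOpen_ball.mem_nhds
        (radial_mem_ball (hball y hy) ⟨ht.1.le, ht.2⟩))).differentiableAt (by simp)).hasFDerivAt
    have h2 : HasFDerivAt (fun y => x₀ + t • (y - x₀)) (t • ContinuousLinearMap.id ℝ E) y :=
      (((hasFDerivAt_id y).sub_const x₀).const_smul t).const_add x₀
    refine ((h1.comp y h2).const_smul (t ^ n)).congr_fderiv ?_
    ext v
    simp [pow_succ, smul_smul]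

lemma fderiv_radialIntegral [ProperSpace E] [CompleteSpace F] {f : E → F}
    (hf : ContDiffOn ℝ ∞ f (Metric.ball x₀ r)) (n : ℕ) :
    Set.EqOn (fderiv ℝ (radialIntegral x₀ n f)) (radialIntegral x₀ (n + 1) (fderiv ℝ f))
      (Metric.ball x₀ r) :=
  fun _ hx => (hasFDerivAt_radialIntegral hf hx n).fderiv

lemma contDiffOn_radialIntegral [ProperSpace E] [CompleteSpace F] {f : E → F}
    (hf : ContDiffOn ℝ ∞ f (Metric.ball x₀ r)) (n : ℕ) :
    ContDiffOn ℝ ∞ (radialIntegral x₀ n f) (Metric.ball x₀ r) := by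
  rw [contDiffOn_infty]
  intro k
  induction k generalizing F f n with
  | zero =>
    exact contDiffOn_zero.2 fun x hx =>
      (hasFDerivAt_radialIntegral hf hx n).continuousAt.continuousWithinAt
  | succ k ih =>
    rw [show ((k + 1 : ℕ) : WithTop ℕ∞) = (k : WithTop ℕ∞) + 1 by norm_cast,
      contDiffOn_succ_iff_fderiv_of_isOpen Metric.isOpen_ball]
    refine ⟨fun x hx =>
      (hasFDerivAt_radialIntegral hf hx n).differentiableAt.differentiableWithinAt, by simp, ?_⟩
    exact (ih (hf.fderiv_of_isOpen Metric.isOpen_ball (by simp)) (n + 1)).congr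
      (fderiv_radialIntegral hf n)

lemma norm_iteratedFDeriv_radialIntegral_le [ProperSpace E] [CompleteSpace F] {f : E → F}
    (hf : ContDiffOn ℝ ∞ f (Metric.ball x₀ r)) (n k : ℕ) {x : E} (hx : x ∈ Metric.ball x₀ r)
    {C : ℝ} (hC : ∀ y ∈ Metric.closedBall x₀ ‖x - x₀‖, ‖iteratedFDeriv ℝ k f y‖ ≤ C) :
    ‖iteratedFDeriv ℝ k (radialIntegral x₀ n f) x‖ ≤ C := by
  induction k generalizing F f n with
  | zero =>
    simp only [norm_iteratedFDeriv_zero] at hC ⊢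
    exact norm_radialIntegral_le hC n
  | succ k ih =>
    rw [← norm_iteratedFDeriv_fderiv, ((fderiv_radialIntegral hf n).eventuallyEq_of_mem
      (Metric.isOpen_ball.mem_nhds hx)).iteratedFDeriv ℝ k |>.eq_of_nhds]
    refine ih (hf.fderiv_of_isOpen Metric.isOpen_ball (by simp)) (n + 1) fun y hy => ?_
    rw [norm_iteratedFDeriv_fderiv]
    exact hC y hy

lemma ModerateFamily.radialIntegral [ProperSpace E] [CompleteSpace F] {f : Eps → E → F}
    (hf : ModerateFamily (Metric.ball x₀ r) f) (n : ℕ) :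
    ModerateFamily (Metric.ball x₀ r) fun ε => radialIntegral x₀ n (f ε) where
  smooth ε := contDiffOn_radialIntegral (hf.smooth ε) n
  bound K hK hKr k := by
    obtain ⟨ρ, hρ, hKρ⟩ := exists_closedBall_of_isCompact_subset_ball hK hKr
    obtain ⟨N, hN⟩ := hf.bound _ (isCompact_closedBall x₀ ρ)
      (Metric.closedBall_subset_ball hρ) k
    exact ⟨N, hN.mono fun ε hε x hx => norm_iteratedFDeriv_radialIntegral_le (hf.smooth ε) n k
      (hKr hx) fun y hy => hε y (Metric.closedBall_subset_closedBall (hKρ x hx) hy)⟩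

end Homotopy

section Poincare

variable {E : Type} [NormedAddCommGroup E] [NormedSpace ℝ E] {x₀ : E} {r : ℝ}

/-- Transposition of bilinear forms, as a continuous linear map. -/
noncomputable def flipL : (E →L[ℝ] E →L[ℝ] ℝ) →L[ℝ] E →L[ℝ] E →L[ℝ] ℝ :=
  (ContinuousLinearMap.flipₗᵢ ℝ E E ℝ).toContinuousLinearEquiv.toContinuousLinearMap

/-- The value `(dβ)(u, v, w)` of the exterior derivative of a field `β` of skew-symmetric forms, in
terms of its derivative `T`; defined for an arbitrary trilinear form `T`. -/
noncomputable def extDerivOf (T : E →L[ℝ] E →L[ℝ] E →L[ℝ] ℝ) (u v w : E) : ℝ :=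
  T u v w - T v u w + T w u v

/-- The primitive `α = ∫₀¹ t β(x₀ + t(x - x₀))(x - x₀, ·) dt` that the radial homotopy operator
assigns to a field `β` of bilinear forms. -/
noncomputable def radialPrimitive (x₀ : E) (β : E → E →L[ℝ] E →L[ℝ] ℝ) (x : E) : E →L[ℝ] ℝ :=
  radialIntegral x₀ 1 β x (x - x₀)

/-- The exterior derivative of `radialPrimitive x₀ β`. -/
noncomputable def closedPart (x₀ : E) (β : E → E →L[ℝ] E →L[ℝ] ℝ) (x : E) : E →L[ℝ] E →L[ℝ] ℝ :=
  fderiv ℝ (radialPrimitive x₀ β) x - (fderiv ℝ (radialPrimitive x₀ β) x).flip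

lemma closedPart_skew (x₀ : E) (β : E → E →L[ℝ] E →L[ℝ] ℝ) (x u v : E) :
    closedPart x₀ β x u v = -closedPart x₀ β x v u := by
  simp [closedPart]

lemma ModerateFamily.closedPart [ProperSpace E] {β : Eps → E → E →L[ℝ] E →L[ℝ] ℝ}
    (hβ : ModerateFamily (Metric.ball x₀ r) β) :
    ModerateFamily (Metric.ball x₀ r) fun ε => closedPart x₀ (β ε) := by
  have h1 : ModerateFamily (Metric.ball x₀ r) fun ε => radialPrimitive x₀ (β ε) :=
    (hβ.radialIntegral 1).bilinear Metric.isOpen_ball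
      (ContinuousLinearMap.id ℝ (E →L[ℝ] E →L[ℝ] ℝ))
      (moderateFamily_const Metric.isOpen_ball (f := fun x => x - x₀) (by fun_prop))
  have h2 := h1.fderiv Metric.isOpen_ball
  exact h2.sub Metric.isOpen_ball (h2.clm_comp Metric.isOpen_ball flipL)

variable {β : E → E →L[ℝ] E →L[ℝ] ℝ}

lemma contDiffOn_radialPrimitive [ProperSpace E] (hβ : ContDiffOn ℝ ∞ β (Metric.ball x₀ r)) :
    ContDiffOn ℝ ∞ (radialPrimitive x₀ β) (Metric.ball x₀ r) :=
  (contDiffOn_radialIntegral hβ 1).clm_apply (by fun_prop)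

/-- An exact form is closed, by the symmetry of second derivatives. -/
lemma extDerivOf_fderiv_closedPart [ProperSpace E] (hβ : ContDiffOn ℝ ∞ β (Metric.ball x₀ r))
    {x : E} (hx : x ∈ Metric.ball x₀ r) (u v w : E) :
    extDerivOf (fderiv ℝ (closedPart x₀ β) x) u v w = 0 := by
  set α := radialPrimitive x₀ β
  have hα' : ContDiffAt ℝ ∞ α x :=
    (contDiffOn_radialPrimitive hβ).contDiffAt (Metric.isOpen_ball.mem_nhds hx)
  have hdiff : DifferentiableAt ℝ (fderiv ℝ α) x :=
    (hα'.fderiv_right (m := ∞) (by simp)).differentiableAt (by simp)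
  have hle : ∀ k : ℕ, (k : WithTop ℕ∞) ≤ ∞ := fun k => by exact_mod_cast le_top
  have hsymm : IsSymmSndFDerivAt ℝ α x := hα'.isSymmSndFDerivAt (by simpa using hle 2)
  have hder : HasFDerivAt (closedPart x₀ β)
      (fderiv ℝ (fderiv ℝ α) x - flipL.comp (fderiv ℝ (fderiv ℝ α) x)) x :=
    hdiff.hasFDerivAt.sub (flipL.hasFDerivAt.comp x hdiff.hasFDerivAt)
  rw [hder.fderiv]
  have h1 := hsymm u v
  have h2 := hsymm u w
  have h3 := hsymm v w
  have hL : ∀ a b c, flipL (fderiv ℝ (fderiv ℝ α) x a) b c = fderiv ℝ (fderiv ℝ α) x a c b :=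
    fun a b c => rfl
  simp only [extDerivOf, sub_apply, ContinuousLinearMap.comp_apply, hL]
  rw [h1, h2, h3]
  ring

/-- Integration of `d/dt (t² β(x₀ + t(x - x₀)))` over `[0,1]`. -/
lemma eq_radialIntegral_add [ProperSpace E] (hβ : ContDiffOn ℝ ∞ β (Metric.ball x₀ r)) {x : E}
    (hx : x ∈ Metric.ball x₀ r) :
    β x = (2 : ℝ) • radialIntegral x₀ 1 β x + radialIntegral x₀ 2 (fderiv ℝ β) x (x - x₀) := by
  have hβ' : ContDiffOn ℝ ∞ (fderiv ℝ β) (Metric.ball x₀ r) :=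
    hβ.fderiv_of_isOpen Metric.isOpen_ball (by simp)
  have i1 := intervalIntegrable_radial hβ.continuousOn hx 1
  have i2 := intervalIntegrable_radial hβ'.continuousOn hx 2
  have i2' : IntervalIntegrable (fun t : ℝ => t ^ 2 • fderiv ℝ β (x₀ + t • (x - x₀)) (x - x₀))
      MeasureTheory.volume 0 1 :=
    ((continuousOn_radial hβ'.continuousOn hx 2).clm_apply continuousOn_const).intervalIntegrable
  have hder : ∀ t ∈ Set.uIcc (0 : ℝ) 1,
      HasDerivAt (fun t : ℝ => t ^ 2 • β (x₀ + t • (x - x₀)))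
        ((2 : ℝ) • (t ^ 1 • β (x₀ + t • (x - x₀))) +
          t ^ 2 • fderiv ℝ β (x₀ + t • (x - x₀)) (x - x₀)) t := by
    intro t ht
    rw [Set.uIcc_of_le zero_le_one] at ht
    have h1 : HasFDerivAt β (fderiv ℝ β (x₀ + t • (x - x₀))) (x₀ + t • (x - x₀)) :=
      ((hβ.contDiffAt (Metric.isOpen_ball.mem_nhds
        (radial_mem_ball hx ht))).differentiableAt (by simp)).hasFDerivAt
    have h2 : HasDerivAt (fun t : ℝ => x₀ + t • (x - x₀)) (x - x₀) t := by
      simpa using ((hasDerivAt_id t).smul_const (x - x₀)).const_add x₀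
    have h3 := (hasDerivAt_pow 2 t).smul (h1.comp_hasDerivAt t h2)
    refine h3.congr_deriv ?_
    simp [smul_smul, add_comm]
  have h := intervalIntegral.integral_eq_sub_of_hasDerivAt hder ((i1.smul (2 : ℝ)).add i2')
  rw [intervalIntegral.integral_add (f := fun t : ℝ => (2 : ℝ) • (t ^ 1 • β (x₀ + t • (x - x₀))))
    (i1.smul (2 : ℝ)) i2', intervalIntegral.integral_smul] at h
  have h4 : radialIntegral x₀ 2 (fderiv ℝ β) x (x - x₀) =
      ∫ t in (0 : ℝ)..1, t ^ 2 • fderiv ℝ β (x₀ + t • (x - x₀)) (x - x₀) :=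
    ContinuousLinearMap.intervalIntegral_apply i2 (x - x₀)
  rw [h4]
  simpa [radialIntegral] using h.symm

/-- The homotopy formula: a field of skew-symmetric forms differs from its closed part by the
radial integral of its exterior derivative. -/
lemma sub_closedPart_apply [ProperSpace E] (hβ : ContDiffOn ℝ ∞ β (Metric.ball x₀ r))
    (hskew : ∀ y ∈ Metric.ball x₀ r, ∀ u v, β y u v = -β y v u) {x : E}
    (hx : x ∈ Metric.ball x₀ r) (u v : E) :
    β x u v - closedPart x₀ β x u v =
      extDerivOf (radialIntegral x₀ 2 (fderiv ℝ β) x) (x - x₀) u v := by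
  have hder : HasFDerivAt (radialPrimitive x₀ β)
      ((radialIntegral x₀ 1 β x).comp (ContinuousLinearMap.id ℝ E) +
        (radialIntegral x₀ 2 (fderiv ℝ β) x).flip (x - x₀)) x :=
    (hasFDerivAt_radialIntegral hβ hx 1).clm_apply ((hasFDerivAt_id x).sub_const x₀)
  have i1 := intervalIntegrable_radial hβ.continuousOn hx 1
  have hI : ∀ a b, radialIntegral x₀ 1 β x a b =
      ∫ t in (0 : ℝ)..1, t ^ 1 • β (x₀ + t • (x - x₀)) a b := by
    intro a b
    rw [radialIntegral, ContinuousLinearMap.intervalIntegral_apply i1,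
      ContinuousLinearMap.intervalIntegral_apply]
    · rfl
    · exact ((continuousOn_radial hβ.continuousOn hx 1).clm_apply
        continuousOn_const).intervalIntegrable
  have hIskew : radialIntegral x₀ 1 β x v u = -radialIntegral x₀ 1 β x u v := by
    rw [hI, hI, ← intervalIntegral.integral_neg]
    refine intervalIntegral.integral_congr fun t ht => ?_
    rw [Set.uIcc_of_le zero_le_one] at ht
    simp only [hskew _ (radial_mem_ball hx ht) v u, smul_neg]
  have h := congrArg (fun B : E →L[ℝ] E →L[ℝ] ℝ => B u v) (eq_radialIntegral_add hβ hx)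
  simp only [add_apply, smul_apply, smul_eq_mul] at h
  rw [closedPart, hder.fderiv, h]
  simp only [extDerivOf, sub_apply, add_apply,
    ContinuousLinearMap.flip_apply, ContinuousLinearMap.comp_id, hIskew]
  ring

lemma norm_sub_closedPart_le [ProperSpace E] (hβ : ContDiffOn ℝ ∞ β (Metric.ball x₀ r))
    (hskew : ∀ y ∈ Metric.ball x₀ r, ∀ u v, β y u v = -β y v u) {C : ℝ} (hC0 : 0 ≤ C)
    (hC : ∀ y ∈ Metric.ball x₀ r, ∀ a u v,
      |extDerivOf (fderiv ℝ β y) a u v| ≤ C * ‖a‖ * ‖u‖ * ‖v‖)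
    {x : E} (hx : x ∈ Metric.ball x₀ r) : ‖β x - closedPart x₀ β x‖ ≤ C * r := by
  have hxr : ‖x - x₀‖ < r := by simpa [dist_eq_norm] using hx
  have hr : 0 ≤ r := (norm_nonneg _).trans hxr.le
  have hβ' : ContDiffOn ℝ ∞ (fderiv ℝ β) (Metric.ball x₀ r) :=
    hβ.fderiv_of_isOpen Metric.isOpen_ball (by simp)
  have i2 := intervalIntegrable_radial hβ'.continuousOn hx 2
  refine ContinuousLinearMap.opNorm_le_bound₂ _ (by positivity) fun u v => ?_
  rw [sub_apply, sub_apply,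
    sub_closedPart_apply hβ hskew hx]
  let ev : E → E → E → (E →L[ℝ] E →L[ℝ] E →L[ℝ] ℝ) →L[ℝ] ℝ := fun a b c =>
    (ContinuousLinearMap.apply ℝ ℝ c).comp ((ContinuousLinearMap.apply ℝ (E →L[ℝ] ℝ) b).comp
      (ContinuousLinearMap.apply ℝ (E →L[ℝ] E →L[ℝ] ℝ) a))
  let ℓ : (E →L[ℝ] E →L[ℝ] E →L[ℝ] ℝ) →L[ℝ] ℝ :=
    ev (x - x₀) u v - ev u (x - x₀) v + ev v (x - x₀) u
  have hℓ : ∀ T, ℓ T = extDerivOf T (x - x₀) u v := fun T => rfl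
  rw [← hℓ, radialIntegral, ← ℓ.intervalIntegral_comp_comm i2]
  have := intervalIntegral.norm_integral_le_of_norm_le_const (a := (0 : ℝ)) (b := 1)
    (C := C * r * ‖u‖ * ‖v‖)
    (f := fun t : ℝ => ℓ (t ^ 2 • fderiv ℝ β (x₀ + t • (x - x₀)))) fun t ht => by
      rw [Set.uIoc_of_le zero_le_one] at ht
      rw [map_smul, hℓ, norm_smul, norm_pow, Real.norm_of_nonneg ht.1.le]
      refine (mul_le_of_le_one_left (norm_nonneg _) (pow_le_one₀ ht.1.le ht.2)).trans ?_
      refine (hC _ (radial_mem_ball hx ⟨ht.1.le, ht.2⟩) _ _ _).trans ?_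
      gcongr
  simpa using this

end Poincare

/-! ### Tensor fields in charts -/

section Charts

variable {d : ℕ} {M : Type*} [TopologicalSpace M] [ChartedSpace (Euc d) M]

/-- The derivative of the inverse chart `e⁻¹` at `z`, with the tangent space of `M` identified with
the model space. -/
noncomputable def chartSymmDeriv (e : OpenPartialHomeomorph M (Euc d)) (z : Euc d) :
    Euc d →L[ℝ] Euc d :=
  mfderiv 𝓘(ℝ, Euc d) (𝓡 d) e.symm z

/-- The derivative of the chart `e` at `x`, with the tangent space of `M` identified with the model
space. -/
noncomputable def chartDeriv (e : OpenPartialHomeomorph M (Euc d)) (x : M) :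
    Euc d →L[ℝ] Euc d :=
  mfderiv (𝓡 d) 𝓘(ℝ, Euc d) e x

/-- A bilinear form on the tangent space at `x`, as a bilinear form on the model space. -/
def TensorField.form (s : TensorField d M) (x : M) : Euc d →L[ℝ] Euc d →L[ℝ] ℝ := s x

/-- The push-forward of the tensor field `s` by the chart `e`, as a field of bilinear forms on the
image of the chart. -/
noncomputable def localForm (e : OpenPartialHomeomorph M (Euc d)) (s : TensorField d M)
    (z : Euc d) : Euc d →L[ℝ] Euc d →L[ℝ] ℝ :=
  (s.form (e.symm z)).bilinearComp (chartSymmDeriv e z) (chartSymmDeriv e z)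

/-- The standard basis vectors of the model space. -/
noncomputable abbrev stdVec (i : Fin d) : Euc d := EuclideanSpace.single i 1

/-- The tensor field on the domain of the chart `e` with push-forward `β`. -/
noncomputable def chartPullback (e : OpenPartialHomeomorph M (Euc d))
    (β : Euc d → Euc d →L[ℝ] Euc d →L[ℝ] ℝ) : TensorField d M := fun x =>
  (β (e x)).bilinearComp (chartDeriv e x) (chartDeriv e x)

variable {e e' : OpenPartialHomeomorph M (Euc d)}

lemma mdifferentiableAt_chart_symm (he : e ∈ charts d M) {z : Euc d} (hz : z ∈ e.target) :
    MDifferentiableAt 𝓘(ℝ, Euc d) (𝓡 d) e.symm z :=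
  ((contMDiffOn_symm_of_mem_maximalAtlas he).contMDiffAt
    (e.open_target.mem_nhds hz)).mdifferentiableAt (by simp)

lemma mdifferentiableAt_chart (he : e ∈ charts d M) {x : M} (hx : x ∈ e.source) :
    MDifferentiableAt (𝓡 d) 𝓘(ℝ, Euc d) e x :=
  (contMDiffAt_of_mem_maximalAtlas he hx).mdifferentiableAt (by simp)

lemma chartDeriv_chartSymmDeriv (he : e ∈ charts d M) {z : Euc d} (hz : z ∈ e.target)
    (v : Euc d) : chartDeriv e (e.symm z) (chartSymmDeriv e z v) = v := by
  have h := mfderiv_comp z (mdifferentiableAt_chart he (e.map_target hz))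
    (mdifferentiableAt_chart_symm he hz)
  have h2 : (e ∘ e.symm) =ᶠ[𝓝 z] id := by
    filter_upwards [e.open_target.mem_nhds hz] with y hy using e.right_inv hy
  rw [h2.mfderiv_eq, mfderiv_id] at h
  exact (congrArg (fun L : Euc d →L[ℝ] Euc d => L v) h).symm

lemma chartSymmDeriv_chartDeriv (he : e ∈ charts d M) {x : M} (hx : x ∈ e.source)
    (v : Euc d) : chartSymmDeriv e (e x) (chartDeriv e x v) = v := by
  have h := mfderiv_comp x (mdifferentiableAt_chart_symm he (e.map_source hx))
    (mdifferentiableAt_chart he hx)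
  have h2 : (e.symm ∘ e) =ᶠ[𝓝 x] id := by
    filter_upwards [e.open_source.mem_nhds hx] with y hy using e.left_inv hy
  rw [h2.mfderiv_eq, mfderiv_id] at h
  exact (congrArg (fun L : Euc d →L[ℝ] Euc d => L v) h).symm

lemma localForm_chartPullback (he : e ∈ charts d M) (β : Euc d → Euc d →L[ℝ] Euc d →L[ℝ] ℝ)
    {z : Euc d} (hz : z ∈ e.target) : localForm e (chartPullback e β) z = β z := by
  ext v w
  change β (e (e.symm z)) (chartDeriv e (e.symm z) (chartSymmDeriv e z v))
    (chartDeriv e (e.symm z) (chartSymmDeriv e z w)) = _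
  rw [chartDeriv_chartSymmDeriv he hz, chartDeriv_chartSymmDeriv he hz, e.right_inv hz]

lemma form_eq_localForm (he : e ∈ charts d M) (s : TensorField d M) {x : M} (hx : x ∈ e.source)
    (v w : Euc d) : s.form x v w = localForm e s (e x) (chartDeriv e x v) (chartDeriv e x w) := by
  change _ = s.form (e.symm (e x)) (chartSymmDeriv e (e x) (chartDeriv e x v))
    (chartSymmDeriv e (e x) (chartDeriv e x w))
  rw [chartSymmDeriv_chartDeriv he hx, chartSymmDeriv_chartDeriv he hx, e.left_inv hx]

lemma contDiffOn_coordChange (he : e ∈ charts d M) (he' : e' ∈ charts d M) :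
    ContDiffOn ℝ ∞ (e ∘ e'.symm) (e'.target ∩ e'.symm ⁻¹' e.source) := by
  rw [← contMDiffOn_iff_contDiffOn]
  exact (contMDiffOn_of_mem_maximalAtlas he).comp
    ((contMDiffOn_symm_of_mem_maximalAtlas he').mono Set.inter_subset_left) fun z hz => hz.2

lemma isOpen_coordChange_source {M : Type*} [TopologicalSpace M]
    {e e' : OpenPartialHomeomorph M (Euc d)} : IsOpen (e'.target ∩ e'.symm ⁻¹' e.source) :=
  e'.symm.isOpen_inter_preimage e.open_source

/-- The transformation law of a `(0,2)`-tensor field under a change of charts. -/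
lemma localForm_coordChange (he : e ∈ charts d M) (he' : e' ∈ charts d M) (s : TensorField d M)
    {z : Euc d} (hz : z ∈ e'.target ∩ e'.symm ⁻¹' e.source) :
    localForm e' s z = (localForm e s ((e ∘ e'.symm) z)).bilinearComp
      (fderiv ℝ (e ∘ e'.symm) z) (fderiv ℝ (e ∘ e'.symm) z) := by
  have h : ∀ v, fderiv ℝ (e ∘ e'.symm) z v =
      chartDeriv e (e'.symm z) (chartSymmDeriv e' z v) := by
    intro v
    have h := mfderiv_comp z (mdifferentiableAt_chart he hz.2)
      (mdifferentiableAt_chart_symm he' hz.1)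
    rw [mfderiv_eq_fderiv] at h
    exact congrArg (fun L : Euc d →L[ℝ] Euc d => L v) h
  ext v w
  rw [ContinuousLinearMap.bilinearComp_apply, h, h, Function.comp_apply,
    ← form_eq_localForm he s hz.2]
  rfl

lemma localForm_chartPullback_coordChange (he : e ∈ charts d M) (he' : e' ∈ charts d M)
    (β : Euc d → Euc d →L[ℝ] Euc d →L[ℝ] ℝ) {z : Euc d}
    (hz : z ∈ e'.target ∩ e'.symm ⁻¹' e.source) :
    localForm e' (chartPullback e β) z = (β ((e ∘ e'.symm) z)).bilinearComp
      (fderiv ℝ (e ∘ e'.symm) z) (fderiv ℝ (e ∘ e'.symm) z) := by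
  rw [localForm_coordChange he he' _ hz,
    localForm_chartPullback he (z := (e ∘ e'.symm) z) _ (e.map_source hz.2)]

variable [IsManifold (𝓡 d) ∞ M]

/-- Smoothness of a tensor field near a point can be checked in the preferred chart at any nearby
point, because that chart defines the trivialization of the tangent bundle. -/
lemma smoothTensorOn_of_localForm {U : Opens M} {s : TensorField d M}
    (h : ∀ x ∈ U, ∃ p : M, x ∈ (chartAt (Euc d) p).source ∧
      ContDiffOn ℝ ∞ (localForm (chartAt (Euc d) p) s) (chartImage (chartAt (Euc d) p) U)) :
    SmoothTensorOn U s := by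
  intro x hx
  obtain ⟨p, hxp, hs⟩ := h x hx
  set e := chartAt (Euc d) p
  have he : e ∈ charts d M := IsManifold.chart_mem_maximalAtlas p
  rw [Bundle.Trivialization.contMDiffWithinAt_section
    (e := trivializationAt (Euc d →L[ℝ] Euc d →L[ℝ] ℝ)
      (fun x : M => TangentSpace (𝓡 d) x →L[ℝ] TangentSpace (𝓡 d) x →L[ℝ] ℝ) p) _
    (by simpa using hxp)]
  have hsm : ContMDiffWithinAt (𝓡 d) 𝓘(ℝ, Euc d →L[ℝ] Euc d →L[ℝ] ℝ) ∞
      (fun y => localForm e s (e y)) U x := by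
    have h1 : ContMDiffAt 𝓘(ℝ, Euc d) 𝓘(ℝ, Euc d →L[ℝ] Euc d →L[ℝ] ℝ) ∞ (localForm e s) (e x) :=
      (hs.contDiffAt ((isOpen_chartImage e U).mem_nhds
        ⟨e.map_source hxp, by simpa [e.left_inv hxp] using hx⟩)).contMDiffAt
    exact (h1.comp x (contMDiffAt_of_mem_maximalAtlas he hxp)).contMDiffWithinAt
  have hev : ∀ᶠ y in 𝓝[U] x, y ∈ e.source :=
    mem_nhdsWithin_of_mem_nhds (e.open_source.mem_nhds hxp)
  have hval : ∀ y ∈ e.source, (trivializationAt (Euc d →L[ℝ] Euc d →L[ℝ] ℝ)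
      (fun x : M => TangentSpace (𝓡 d) x →L[ℝ] TangentSpace (𝓡 d) x →L[ℝ] ℝ) p
        ⟨y, s y⟩).2 = localForm e s (e y) := by
    intro y hy
    ext v w
    have hy' : y ∈ (trivializationAt (Euc d) (TangentSpace (𝓡 d) : M → Type _) p).baseSet := by
      simpa using hy
    rw [hom_trivializationAt_apply]
    refine (inCoordinates_apply_eq₂ (F₃ := ℝ) (E₃ := Bundle.Trivial M ℝ) hy' hy'
      (Set.mem_univ y)).trans ?_
    have hsymm : ∀ v, (trivializationAt (Euc d) (TangentSpace (𝓡 d) : M → Type _) p).symm y v =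
        chartSymmDeriv e (e y) v := by
      intro v
      have := congrArg (fun L : Euc d →L[ℝ] Euc d => L v)
        (TangentBundle.symmL_trivializationAt (I := 𝓡 d) hy)
      refine Eq.trans ?_ (this.trans ?_)
      · exact (Bundle.Trivialization.symmL_apply (R := ℝ) _ hy' v).symm
      · simp [mfderivWithin_univ, chartSymmDeriv]
        rfl
    simp only [Bundle.Trivial.fiberBundle_trivializationAt',
      Bundle.Trivial.linearMapAt_trivialization, LinearMap.id_coe, id_eq]
    rw [hsymm, hsymm]
    change s.form y _ _ = s.form (e.symm (e y)) _ _
    rw [e.left_inv hy]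
    rfl
  refine hsm.congr_of_eventuallyEq (hev.mono fun y hy => hval y hy) (hval x hxp)

end Charts

/-! ### Components and exterior derivatives of local forms -/

section Forms

variable {d : ℕ}

lemma sum_smul_stdVec (v : Euc d) : ∑ i, v i • stdVec i = v := by
  ext j
  simp [Pi.single_apply]

/-- The form `dxⁱ ⊗ dxʲ`. -/
noncomputable def coordForm (i j : Fin d) : Euc d →L[ℝ] Euc d →L[ℝ] ℝ :=
  (EuclideanSpace.proj i : Euc d →L[ℝ] ℝ).smulRight (EuclideanSpace.proj j : Euc d →L[ℝ] ℝ)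

lemma bilinear_apply_eq_sum (B : Euc d →L[ℝ] Euc d →L[ℝ] ℝ) (v w : Euc d) :
    B v w = ∑ i, ∑ j, v i * w j * B (stdVec i) (stdVec j) := by
  conv_lhs => rw [← sum_smul_stdVec v, ← sum_smul_stdVec w]
  simp only [map_sum, map_smul, sum_apply, smul_apply, smul_eq_mul, Finset.mul_sum]
  rw [Finset.sum_comm]
  refine Finset.sum_congr rfl fun i _ => Finset.sum_congr rfl fun j _ => ?_
  ring

lemma bilinear_eq_sum_coordForm (B : Euc d →L[ℝ] Euc d →L[ℝ] ℝ) :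
    B = ∑ i, ∑ j, B (stdVec i) (stdVec j) • coordForm i j := by
  ext v w
  rw [bilinear_apply_eq_sum]
  simp only [sum_apply, smul_apply]
  refine Finset.sum_congr rfl fun i _ => Finset.sum_congr rfl fun j _ => ?_
  change _ = B (stdVec i) (stdVec j) * (v i * w j)
  ring

lemma norm_bilinear_le_sum (B : Euc d →L[ℝ] Euc d →L[ℝ] ℝ) :
    ‖B‖ ≤ ∑ i, ∑ j, |B (stdVec i) (stdVec j)| := by
  refine ContinuousLinearMap.opNorm_le_bound₂ _ (by positivity) fun v w => ?_
  rw [bilinear_apply_eq_sum]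
  simp only [Finset.sum_mul]
  refine (Finset.abs_sum_le_sum_abs _ _).trans (Finset.sum_le_sum fun i _ => ?_)
  refine (Finset.abs_sum_le_sum_abs _ _).trans (Finset.sum_le_sum fun j _ => ?_)
  rw [abs_mul, abs_mul]
  have h1 : |v i| ≤ ‖v‖ := PiLp.norm_apply_le v i
  have h2 : |w j| ≤ ‖w‖ := PiLp.norm_apply_le w j
  calc _ ≤ ‖v‖ * ‖w‖ * |B (stdVec i) (stdVec j)| := by gcongr
    _ = _ := by ring

lemma abs_apply_stdVec_le (B : Euc d →L[ℝ] Euc d →L[ℝ] ℝ) (i j : Fin d) :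
    |B (stdVec i) (stdVec j)| ≤ ‖B‖ := by
  simpa using B.le_opNorm₂ (stdVec i) (stdVec j)

lemma extDerivOf_eq_sum (T : Euc d →L[ℝ] Euc d →L[ℝ] Euc d →L[ℝ] ℝ) (a u v : Euc d) :
    extDerivOf T a u v = ∑ i, ∑ j, ∑ k,
      a i * u j * v k * extDerivOf T (stdVec i) (stdVec j) (stdVec k) := by
  have key : ∀ a b c : Euc d, T a b c = ∑ i, ∑ j, ∑ k,
      a i * b j * c k * T (stdVec i) (stdVec j) (stdVec k) := by
    intro a b c
    conv_lhs => rw [← sum_smul_stdVec a]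
    simp only [map_sum, map_smul, sum_apply, smul_apply, smul_eq_mul]
    refine Finset.sum_congr rfl fun i _ => ?_
    rw [bilinear_apply_eq_sum, Finset.mul_sum]
    refine Finset.sum_congr rfl fun j _ => ?_
    rw [Finset.mul_sum]
    refine Finset.sum_congr rfl fun k _ => ?_
    ring
  have h2 : T u a v = ∑ i, ∑ j, ∑ k,
      a i * u j * v k * T (stdVec j) (stdVec i) (stdVec k) := by
    rw [key, Finset.sum_comm]
    refine Finset.sum_congr rfl fun i _ => Finset.sum_congr rfl fun j _ =>
      Finset.sum_congr rfl fun k _ => ?_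
    ring
  have h3 : T v a u = ∑ i, ∑ j, ∑ k,
      a i * u j * v k * T (stdVec k) (stdVec i) (stdVec j) := by
    rw [key, Finset.sum_comm]
    refine Finset.sum_congr rfl fun i _ => ?_
    rw [Finset.sum_comm]
    refine Finset.sum_congr rfl fun j _ => Finset.sum_congr rfl fun k _ => ?_
    ring
  rw [extDerivOf, key a, h2, h3]
  simp only [extDerivOf, mul_add, mul_sub, Finset.sum_add_distrib, Finset.sum_sub_distrib]

lemma abs_extDerivOf_le (T : Euc d →L[ℝ] Euc d →L[ℝ] Euc d →L[ℝ] ℝ) (a u v : Euc d) :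
    |extDerivOf T a u v| ≤ (∑ i, ∑ j, ∑ k,
      |extDerivOf T (stdVec i) (stdVec j) (stdVec k)|) * ‖a‖ * ‖u‖ * ‖v‖ := by
  rw [extDerivOf_eq_sum]
  simp only [Finset.sum_mul]
  refine (Finset.abs_sum_le_sum_abs _ _).trans (Finset.sum_le_sum fun i _ => ?_)
  refine (Finset.abs_sum_le_sum_abs _ _).trans (Finset.sum_le_sum fun j _ => ?_)
  refine (Finset.abs_sum_le_sum_abs _ _).trans (Finset.sum_le_sum fun k _ => ?_)
  rw [abs_mul, abs_mul, abs_mul]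
  have h1 : |a i| ≤ ‖a‖ := PiLp.norm_apply_le a i
  have h2 : |u j| ≤ ‖u‖ := PiLp.norm_apply_le u j
  have h3 : |v k| ≤ ‖v‖ := PiLp.norm_apply_le v k
  calc _ ≤ ‖a‖ * ‖u‖ * ‖v‖ * |extDerivOf T (stdVec i) (stdVec j) (stdVec k)| := by gcongr
    _ = _ := by ring

/-- The exterior derivative of a `2`-form commutes with pull-back. The second derivatives of the
map `τ` cancel by their symmetry and the skew-symmetry of the form. -/
lemma extDerivOf_pullback {β γ : Euc d → Euc d →L[ℝ] Euc d →L[ℝ] ℝ} {τ : Euc d → Euc d}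
    {z : Euc d} (hβ : DifferentiableAt ℝ β (τ z)) (hγ : DifferentiableAt ℝ γ z)
    (hτ : ContDiffAt ℝ ∞ τ z) (hskew : ∀ u v, β (τ z) u v = -β (τ z) v u)
    (h : γ =ᶠ[𝓝 z] fun y => (β (τ y)).bilinearComp (fderiv ℝ τ y) (fderiv ℝ τ y)) (u v w : Euc d) :
    extDerivOf (fderiv ℝ γ z) u v w =
      extDerivOf (fderiv ℝ β (τ z)) (fderiv ℝ τ z u) (fderiv ℝ τ z v) (fderiv ℝ τ z w) := by
  have hle : ∀ k : ℕ, (k : WithTop ℕ∞) ≤ ∞ := fun k => by exact_mod_cast le_top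
  have hτ1 : HasFDerivAt τ (fderiv ℝ τ z) z := (hτ.differentiableAt (by simp)).hasFDerivAt
  have hτ2 : HasFDerivAt (fderiv ℝ τ) (fderiv ℝ (fderiv ℝ τ) z) z :=
    ((hτ.fderiv_right (m := ∞) (by simp)).differentiableAt (by simp)).hasFDerivAt
  have hsymm : IsSymmSndFDerivAt ℝ τ z := hτ.isSymmSndFDerivAt (by simpa using hle 2)
  have key : ∀ a b c, fderiv ℝ γ z a b c =
      fderiv ℝ β (τ z) (fderiv ℝ τ z a) (fderiv ℝ τ z b) (fderiv ℝ τ z c) +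
        β (τ z) (fderiv ℝ (fderiv ℝ τ) z a b) (fderiv ℝ τ z c) +
        β (τ z) (fderiv ℝ τ z b) (fderiv ℝ (fderiv ℝ τ) z a c) := by
    intro a b c
    have h1 := (hγ.hasFDerivAt.clm_apply (hasFDerivAt_const b z)).clm_apply (hasFDerivAt_const c z)
    have h2 := ((hβ.hasFDerivAt.comp z hτ1).clm_apply
      (hτ2.clm_apply (hasFDerivAt_const b z))).clm_apply (hτ2.clm_apply (hasFDerivAt_const c z))
    have h3 : (fun y => γ y b c) =ᶠ[𝓝 z]
        fun y => β (τ y) (fderiv ℝ τ y b) (fderiv ℝ τ y c) :=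
      h.mono fun y hy => congrArg (fun B : Euc d →L[ℝ] Euc d →L[ℝ] ℝ => B b c) hy
    have h4 := congrArg (fun L : Euc d →L[ℝ] ℝ => L a) (h1.unique (h2.congr_of_eventuallyEq h3))
    simp at h4
    rw [h4]
    ring
  simp only [extDerivOf, key]
  rw [hsymm u v, hsymm u w, hsymm v w]
  rw [hskew (fderiv ℝ τ z u) (fderiv ℝ (fderiv ℝ τ) z w v)]
  rw [hskew (fderiv ℝ τ z v) (fderiv ℝ (fderiv ℝ τ) z w u)]
  ring

variable {M : Type*} [TopologicalSpace M] [ChartedSpace (Euc d) M]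
  {e e' : OpenPartialHomeomorph M (Euc d)} {U : Opens M}

lemma extDerivComponent_eq {s : TensorField d M} {z : Euc d}
    (hs : DifferentiableAt ℝ (localForm e s) z) (i j k : Fin d) :
    extDerivComponent e s i j k z =
      extDerivOf (fderiv ℝ (localForm e s) z) (stdVec i) (stdVec j) (stdVec k) := by
  have key : ∀ a b c : Fin d, partialDeriv a (component e s b c) z =
      fderiv ℝ (localForm e s) z (stdVec a) (stdVec b) (stdVec c) := by
    intro a b c
    have h1 := (hs.hasFDerivAt.clm_apply (hasFDerivAt_const (stdVec b) z)).clm_apply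
      (hasFDerivAt_const (stdVec c) z)
    have h2 : component e s b c = fun y => localForm e s y (stdVec b) (stdVec c) := rfl
    rw [partialDeriv, h2, h1.fderiv]
    simp
  simp only [extDerivComponent, key, extDerivOf]

lemma isModerate_of_localForm {s : Eps → TensorField d M}
    (h : ∀ e ∈ charts d M, ModerateFamily (chartImage e U) fun ε => localForm e (s ε)) :
    IsModerate U s := by
  intro e he K hK hKU i j k
  have h1 := ((h e he).clm_comp (isOpen_chartImage e U)
    ((ContinuousLinearMap.apply ℝ ℝ (stdVec j)).comp
      (ContinuousLinearMap.apply ℝ (Euc d →L[ℝ] ℝ) (stdVec i)))).bound K hK hKU k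
  exact h1.exists_bound

lemma differByNegligible_iff {s t : Eps → TensorField d M} :
    DifferByNegligible U s t ↔ ∀ e ∈ charts d M, ∀ K : Set (Euc d), IsCompact K →
      K ⊆ chartImage e U →
      UniformlyNegligibleOn K fun ε z => ‖localForm e (s ε) z - localForm e (t ε) z‖ := by
  refine ⟨fun h e he K hK hKU => ?_, fun h e he K hK hKU i j m => ?_⟩
  · have h1 : UniformlyNegligibleOn K fun ε z => ∑ i, ∑ j,
        |component e (s ε) i j z - component e (t ε) i j z| :=
      UniformlyNegligibleOn.sum _ fun i _ => UniformlyNegligibleOn.sum _ fun j _ =>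
        uniformlyNegligibleOn_of_bound (h e he K hK hKU i j)
    exact h1.mono_fun fun ε z _ => norm_bilinear_le_sum _
  · have h1 : UniformlyNegligibleOn K
        fun ε z => |component e (s ε) i j z - component e (t ε) i j z| :=
      (h e he K hK hKU).mono_fun fun ε z _ => abs_apply_stdVec_le
        (localForm e (s ε) z - localForm e (t ε) z) i j
    exact h1.exists_bound m

variable [IsManifold (𝓡 d) ∞ M]

lemma contDiffOn_localForm {s : TensorField d M} (hs : SmoothTensorOn U s) (he : e ∈ charts d M) :
    ContDiffOn ℝ ∞ (localForm e s) (chartImage e U) := by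
  have h : localForm e s = fun z => ∑ i, ∑ j, component e s i j z • coordForm i j :=
    funext fun z => bilinear_eq_sum_coordForm _
  rw [h]
  exact ContDiffOn.sum fun i _ => ContDiffOn.sum fun j _ =>
    (contDiffOn_component hs he i j).smul contDiffOn_const

/-- A smooth `2`-form that is closed in one chart is closed in every other chart. -/
lemma extDerivComponent_eq_zero_of_chart {s : TensorField d M} (hs : SmoothTensorOn U s)
    (hskew : IsSkewOn U s) (he : e ∈ charts d M) (he' : e' ∈ charts d M) {z : Euc d}
    (hz : z ∈ chartImage e' U) (hze : e'.symm z ∈ e.source)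
    (hclosed : ∀ u v w, extDerivOf (fderiv ℝ (localForm e s) (e (e'.symm z))) u v w = 0)
    (i j k : Fin d) : extDerivComponent e' s i j k z = 0 := by
  have hmem : e (e'.symm z) ∈ chartImage e U :=
    ⟨e.map_source hze, by simpa [e.left_inv hze] using hz.2⟩
  have hβ : DifferentiableAt ℝ (localForm e s) ((e ∘ e'.symm) z) :=
    ((contDiffOn_localForm hs he).contDiffAt
      ((isOpen_chartImage e U).mem_nhds hmem)).differentiableAt (by simp)
  have hγ : DifferentiableAt ℝ (localForm e' s) z :=
    ((contDiffOn_localForm hs he').contDiffAt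
      ((isOpen_chartImage e' U).mem_nhds hz)).differentiableAt (by simp)
  have hzs : z ∈ e'.target ∩ e'.symm ⁻¹' e.source := ⟨hz.1, hze⟩
  have hτ := (contDiffOn_coordChange he he').contDiffAt (isOpen_coordChange_source.mem_nhds hzs)
  rw [extDerivComponent_eq hγ, extDerivOf_pullback hβ hγ hτ ?_ ?_]
  · exact hclosed _ _ _
  · exact fun u v => hskew (e.symm (e (e'.symm z))) hmem.2
      (chartSymmDeriv e (e (e'.symm z)) u) (chartSymmDeriv e (e (e'.symm z)) v)
  · filter_upwards [isOpen_coordChange_source.mem_nhds hzs] with y hy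
    exact localForm_coordChange he he' s hy

/-! ### Moderate and negligible nets of tensor fields -/

lemma ModerateFamily.localForm (s : TensorNet (d := d) U) (he : e ∈ charts d M) :
    ModerateFamily (chartImage e U) fun ε => localForm e (s.toFun ε) := by
  have hO := isOpen_chartImage e U
  have hc : ∀ i j, ModerateFamily (chartImage e U) fun ε => component e (s.toFun ε) i j :=
    fun i j =>
    { smooth ε := contDiffOn_component (s.smooth ε) he i j
      bound K hK hKU k := by
        obtain ⟨N, C, h⟩ := s.moderate e he K hK hKU i j k
        exact uniformlyModerateOn_of_bound h }
  refine (ModerateFamily.sum hO Finset.univ fun i _ => ModerateFamily.sum hO Finset.univ fun j _ =>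
    (hc i j).clm_comp hO ((ContinuousLinearMap.id ℝ ℝ).smulRight (coordForm i j))).congr hO
    (f := fun ε z => ∑ i, ∑ j, component e (s.toFun ε) i j z • coordForm i j) fun ε z _ => ?_
  exact bilinear_eq_sum_coordForm _

end Forms

/-! ### Linear algebra over the ring of generalized numbers -/

section Algebra

variable {d : ℕ}

/-- Evaluation of a moderate net at `ε`. -/
def evalAt (ε : Eps) : moderateSubring →+* ℝ :=
  (Pi.evalRingHom (fun _ : Eps => ℝ) ε).comp moderateSubring.subtype

/-- The matrix over the ring of moderate nets with given entries. -/
def moderateMatrix (a : Fin d → Fin d → Eps → ℝ) (ha : ∀ i j, ModerateNumber (a i j)) :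
    Matrix (Fin d) (Fin d) moderateSubring :=
  Matrix.of fun i j => ⟨a i j, ha i j⟩

lemma det_moderateMatrix_apply (a : Fin d → Fin d → Eps → ℝ) (ha : ∀ i j, ModerateNumber (a i j))
    (ε : Eps) :
    (moderateMatrix a ha).det.1 ε = (Matrix.of fun i j => a i j ε).det :=
  (evalAt ε).map_det (moderateMatrix a ha)

lemma vecMul_moderateMatrix_apply (a : Fin d → Fin d → Eps → ℝ)
    (ha : ∀ i j, ModerateNumber (a i j)) (v : Fin d → moderateSubring) (j : Fin d) (ε : Eps) :
    (Matrix.vecMul v (moderateMatrix a ha) j).1 ε =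
      Matrix.vecMul (fun i => (v i).1 ε) (Matrix.of fun i j => a i j ε) j :=
  (evalAt ε).map_vecMul (moderateMatrix a ha) v j

lemma NegligibleNumber.moderate {r : Eps → ℝ} (h : NegligibleNumber r) : ModerateNumber r :=
  ⟨0, by simpa using h 0⟩

/-- Negligible perturbations of the entries of a moderate matrix perturb the determinant by a
negligible net, since the determinant is well defined over the quotient ring. -/
lemma negligible_det_sub_det {a b : Fin d → Fin d → Eps → ℝ} (ha : ∀ i j, ModerateNumber (a i j))
    (hab : ∀ i j, NegligibleNumber (a i j - b i j)) :
    NegligibleNumber ((fun ε => (Matrix.of fun i j => a i j ε).det) -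
      fun ε => (Matrix.of fun i j => b i j ε).det) := by
  have hb : ∀ i j, ModerateNumber (b i j) := fun i j => by
    have := moderateSubring.sub_mem (ha i j) (hab i j).moderate
    rwa [sub_sub_cancel] at this
  have h : Ideal.Quotient.mk negligibleIdeal (moderateMatrix a ha).det =
      Ideal.Quotient.mk negligibleIdeal (moderateMatrix b hb).det := by
    rw [RingHom.map_det, RingHom.map_det]
    congr 1
    ext i j
    exact Ideal.Quotient.eq.2 (hab i j)
  have h2 : NegligibleNumber ((moderateMatrix a ha).det.1 - (moderateMatrix b hb).det.1) :=
    Ideal.Quotient.eq.1 h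
  convert h2 using 2
  · exact funext fun ε => (det_moderateMatrix_apply a ha ε).symm
  · exact funext fun ε => (det_moderateMatrix_apply b hb ε).symm

/-- A moderate net that is eventually bounded below in modulus by a power of `ε` represents a unit
of the ring of generalized numbers. -/
lemma isUnit_mk_of_le {r : moderateSubring} {m : ℕ}
    (h : ∀ᶠ ε : Eps in small, (ε : ℝ) ^ m ≤ |r.1 ε|) :
    IsUnit (Ideal.Quotient.mk negligibleIdeal r) := by
  have hinv : ModerateNumber fun ε => (r.1 ε)⁻¹ := by
    refine ⟨m, IsBigO.of_bound 1 (h.mono fun ε hε => ?_)⟩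
    have h0 : (0 : ℝ) < (ε : ℝ) ^ m := pow_pos ε.2.1 m
    rw [norm_inv, norm_inv, one_mul, Real.norm_of_nonneg h0.le]
    exact inv_anti₀ h0 hε
  refine IsUnit.of_mul_eq_one (Ideal.Quotient.mk negligibleIdeal ⟨_, hinv⟩) ?_
  rw [← map_mul, ← map_one (Ideal.Quotient.mk negligibleIdeal), Ideal.Quotient.eq]
  intro k
  refine IsBigO.of_bound 0 (h.mono fun ε hε => ?_)
  have h0 : r.1 ε ≠ 0 := abs_pos.1 (lt_of_lt_of_le (pow_pos ε.2.1 m) hε)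
  change ‖r.1 ε * (r.1 ε)⁻¹ - 1‖ ≤ _
  rw [mul_inv_cancel₀ h0]
  simp

lemma toBilin'_apply_eq_vecMul {R : Type*} [CommRing R] (A : Matrix (Fin d) (Fin d) R)
    (v w : Fin d → R) : Matrix.toBilin' A v w = Matrix.vecMul v A ⬝ᵥ w := by
  rw [Matrix.toBilin'_apply', Matrix.dotProduct_mulVec]

lemma eq_zero_of_toBilin'_eq_zero {R : Type*} [CommRing R] {A : Matrix (Fin d) (Fin d) R}
    (hA : IsUnit A.det) {v : Fin d → R} (h : ∀ w, Matrix.toBilin' A v w = 0) : v = 0 := by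
  have h1 : Matrix.vecMul v A = 0 := by
    ext j
    have := h (Pi.single j 1)
    rwa [toBilin'_apply_eq_vecMul, dotProduct_single_one] at this
  calc v = Matrix.vecMul v (A * A⁻¹) := by rw [Matrix.mul_nonsing_inv A hA, Matrix.vecMul_one]
    _ = 0 := by rw [← Matrix.vecMul_vecMul, h1, Matrix.zero_vecMul]

/-- If the determinant of a real matrix is small, then the matrix shrinks some unit vector:
otherwise the entries of its inverse, hence the inverse of its determinant, would be bounded. -/
lemma exists_norm_vecMul_le (A : Matrix (Fin d) (Fin d) ℝ) {c : ℝ} (hc : 0 < c)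
    (h : (d.factorial : ℝ) * |A.det| < c ^ d) :
    ∃ v : Fin d → ℝ, ‖v‖ = 1 ∧ ‖Matrix.vecMul v A‖ ≤ c := by
  by_contra! hcon
  have hle : ∀ v : Fin d → ℝ, ‖v‖ * c ≤ ‖Matrix.vecMul v A‖ := by
    intro v
    rcases eq_or_ne v 0 with rfl | hv
    · simp
    · have hv0 : 0 < ‖v‖ := norm_pos_iff.2 hv
      have h1 := hcon (‖v‖⁻¹ • v) (by rw [norm_smul, norm_inv, norm_norm, inv_mul_cancel₀ hv0.ne'])
      rw [Matrix.smul_vecMul, norm_smul, norm_inv, norm_norm, lt_inv_mul_iff₀ hv0] at h1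
      exact h1.le
  have hdet : A.det ≠ 0 := by
    intro h0
    obtain ⟨v, hv, hvA⟩ := Matrix.exists_vecMul_eq_zero_iff.2 h0
    have h1 := hle v
    rw [hvA, norm_zero] at h1
    exact absurd h1 (not_le.2 (mul_pos (norm_pos_iff.2 hv) hc))
  have hentry : ∀ i j, |A⁻¹ i j| ≤ c⁻¹ := by
    intro i j
    have h1 := hle (A⁻¹ i)
    have h2 : Matrix.vecMul (A⁻¹ i) A = (1 : Matrix (Fin d) (Fin d) ℝ) i := by
      rw [← Matrix.nonsing_inv_mul A (isUnit_iff_ne_zero.2 hdet)]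
      rfl
    have h3 : ‖(1 : Matrix (Fin d) (Fin d) ℝ) i‖ ≤ 1 := by
      refine (pi_norm_le_iff_of_nonneg zero_le_one).2 fun k => ?_
      rw [Matrix.one_apply]
      split_ifs <;> simp
    rw [h2] at h1
    rw [← one_div c, le_div_iff₀ hc]
    exact (mul_le_mul_of_nonneg_right (norm_le_pi_norm (A⁻¹ i) j) hc.le).trans (h1.trans h3)
  have h1 := Matrix.det_le (abv := AbsoluteValue.abs) (A := A⁻¹) (x := c⁻¹) hentry
  rw [Fintype.card_fin, nsmul_eq_mul, AbsoluteValue.abs_apply, Matrix.det_nonsing_inv,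
    Ring.inverse_eq_inv', abs_inv, inv_pow, ← div_eq_mul_inv,
    le_div_iff₀ (pow_pos hc d), inv_mul_le_iff₀ (abs_pos.2 hdet)] at h1
  linarith [mul_comm (d.factorial : ℝ) |A.det|]

/-- Selection along a sequence `ε_k → 0`: if `P m` holds for arbitrarily small `ε`, for each `m`,
then there is a set `S` of parameters, accumulating at `0`, on which `P (k ε) ε` holds with
`k ε → ∞`. -/
lemma exists_set_of_frequently {P : ℕ → Eps → Prop} (h : ∀ m, ∃ᶠ ε in small, P m ε) :
    ∃ (S : Set Eps) (k : Eps → ℕ), (∃ᶠ ε in small, ε ∈ S) ∧ (∀ ε ∈ S, P (k ε) ε) ∧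
      ∀ m, ∀ᶠ ε in small, ε ∈ S → m ≤ k ε := by
  have hlt : ∀ η : ℝ, 0 < η → ∀ᶠ ε : Eps in small, (ε : ℝ) < η := fun η hη =>
    eventually_small.2 ⟨η, hη, fun _ h => h⟩
  have hex : ∀ n : ℕ, ∃ ε : Eps, P n ε ∧ (ε : ℝ) < 1 / (n + 1) := fun n =>
    ((h n).and_eventually (hlt _ (by positivity))).exists
  choose u hu hu' using hex
  have hk : ∀ ε ∈ Set.range u, ∃ n, u n = ε := fun ε h => h
  choose! k hk using hk
  refine ⟨Set.range u, k, ?_, fun ε hε => ?_, fun m => ?_⟩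
  · intro hno
    obtain ⟨η, hη, hno⟩ := eventually_small.1 hno
    obtain ⟨n, hn⟩ := exists_nat_one_div_lt hη
    exact hno (u n) ((hu' n).trans hn) ⟨n, rfl⟩
  · have := hu (k ε)
    rwa [hk ε hε] at this
  · have hall : ∀ᶠ ε : Eps in small, ∀ n ∈ Finset.range m, (ε : ℝ) < u n :=
      (Finset.eventually_all _).2 fun n _ => hlt _ (u n).2.1
    refine hall.mono fun ε hε hS => ?_
    by_contra! hlt
    have := hε (k ε) (Finset.mem_range.2 hlt)
    rw [hk ε hS] at this
    exact lt_irrefl _ this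

end Algebra

/-! ### Non-degeneracy and strict positivity of the volume -/

section Volume

variable {d : ℕ} {M : Type*} [TopologicalSpace M] [ChartedSpace (Euc d) M] [IsManifold (𝓡 d) ∞ M]
  {U : Opens M}

lemma value_mk (s : TensorNet (d := d) U) {e : OpenPartialHomeomorph M (Euc d)}
    (he : e ∈ charts d M) (z : CompactNet (chartImage e U)) :
    (GenTensor.mk s).value e he (Quotient.mk (compactNetSetoid _) z) =
      (Ideal.Quotient.mk negligibleIdeal).mapMatrix
        (moderateMatrix (fun i j ε => component e (s.toFun ε) i j (z.1 ε))
          (moderateNumber_component s he z)) :=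
  rfl

lemma volCoeff_sq {M : Type*} [TopologicalSpace M] [ChartedSpace (Euc d) M]
    (e : OpenPartialHomeomorph M (Euc d)) (s : TensorField d M) (z : Euc d) :
    volCoeff e s z ^ 2 = |(localMatrix e s z).det| :=
  Real.sq_sqrt (abs_nonneg _)

lemma nondegenerate_of_volStrictlyPositive {σ : GenTensor d U} (hσ : σ.VolStrictlyPositive)
    {e : OpenPartialHomeomorph M (Euc d)} (he : e ∈ charts d M) (z : GenPoint (chartImage e U))
    {v : Fin d → GenReal} (hv : ∀ w, Matrix.toBilin' (σ.value e he z) v w = 0) : v = 0 := by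
  obtain ⟨s, rfl⟩ : ∃ s, GenTensor.mk s = σ := Quotient.exists_rep σ
  obtain ⟨y, rfl⟩ := Quotient.exists_rep z
  refine eq_zero_of_toBilin'_eq_zero ?_ hv
  obtain ⟨K, hK, hKU, hy⟩ := y.2.2
  obtain ⟨m, hm⟩ := hσ s rfl e he K hK hKU
  rw [value_mk, ← RingHom.map_det]
  refine isUnit_mk_of_le (m := m * 2) ((hm.and hy).mono fun ε hε => ?_)
  rw [det_moderateMatrix_apply, pow_mul]
  have h1 := pow_le_pow_left₀ (pow_nonneg ε.2.1.le m) (hε.1 _ hε.2) 2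
  rwa [volCoeff_sq] at h1

/-- If the volume is not bounded below by a power of `ε` on `K`, then there are points `z_ε` of `K`
and vectors `v_ε`, of norm one for arbitrarily small `ε`, whose products with the matrices at `z_ε`
are negligible. They define a non-zero generalized vector in the kernel of a point value. -/
lemma volStrictlyPositive_of_nondegenerate {σ : GenTensor d U}
    (hσ : ∀ (e : OpenPartialHomeomorph M (Euc d)) (he : e ∈ charts d M)
      (z : GenPoint (chartImage e U)) (v : Fin d → GenReal),
      (∀ w, Matrix.toBilin' (σ.value e he z) v w = 0) → v = 0) : σ.VolStrictlyPositive := by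
  rintro s rfl e he K hK hKU
  by_contra! hcon
  have hP : ∀ m : ℕ, ∃ᶠ ε : Eps in small, ∃ z ∈ K, ∃ v : Fin d → ℝ, ‖v‖ = 1 ∧
      ‖Matrix.vecMul v (localMatrix e (s.toFun ε) z)‖ ≤ (ε : ℝ) ^ m := by
    intro m
    refine ((hcon (m * d + 1)).and_eventually
      (eventually_mul_le_one (d.factorial : ℝ))).mono fun ε hε => ?_
    obtain ⟨⟨z, hz, hlt⟩, hfac⟩ := hε
    refine ⟨z, hz, exists_norm_vecMul_le _ (pow_pos ε.2.1 m) ?_⟩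
    -- The surplus factor `ε` in the bound for the determinant absorbs the constant `d!`.
    have h0 : (0 : ℝ) < ε := ε.2.1
    have h1 : |(localMatrix e (s.toFun ε) z).det| < (ε : ℝ) ^ (m * d + 1) := by
      rw [← volCoeff_sq]
      calc volCoeff e (s.toFun ε) z ^ 2 < ((ε : ℝ) ^ (m * d + 1)) ^ 2 :=
            pow_lt_pow_left₀ hlt (Real.sqrt_nonneg _) two_ne_zero
        _ = (ε : ℝ) ^ ((m * d + 1) * 2) := by rw [pow_mul]
        _ ≤ _ := ε.pow_le_pow (by omega)
    calc (d.factorial : ℝ) * |(localMatrix e (s.toFun ε) z).det|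
        < d.factorial * (ε : ℝ) ^ (m * d + 1) := by
          have : (0 : ℝ) < d.factorial := by exact_mod_cast d.factorial_pos
          gcongr
      _ = (d.factorial * ε) * (ε : ℝ) ^ (m * d) := by ring
      _ ≤ 1 * (ε : ℝ) ^ (m * d) := by gcongr
      _ = ((ε : ℝ) ^ m) ^ d := by rw [one_mul, pow_mul]
  obtain ⟨S, k, hS, hSP, hk⟩ := exists_set_of_frequently hP
  have hKne : K.Nonempty := by
    obtain ⟨ε, hε⟩ := hS.exists
    obtain ⟨z, hz, _⟩ := hSP ε hε
    exact ⟨z, hz⟩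
  obtain ⟨z₀, hz₀⟩ := hKne
  -- Off `S` the vector is zero, so that its product with the matrix is negligible there as well.
  have hzv : ∀ ε : Eps, ∃ z ∈ K, ∃ v : Fin d → ℝ, ‖v‖ ≤ 1 ∧ (ε ∈ S → ‖v‖ = 1) ∧
      (ε ∈ S → ‖Matrix.vecMul v (localMatrix e (s.toFun ε) z)‖ ≤ (ε : ℝ) ^ k ε) ∧
      (ε ∉ S → v = 0) := by
    intro ε
    by_cases hε : ε ∈ S
    · obtain ⟨z, hz, v, hv, hvA⟩ := hSP ε hε
      exact ⟨z, hz, v, hv.le, fun _ => hv, fun _ => hvA, fun h => absurd hε h⟩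
    · exact ⟨z₀, hz₀, 0, by simp, fun h => absurd h hε, fun h => absurd h hε, fun _ => rfl⟩
  choose z hzK v hv1 hvS hvA hv0 using hzv
  have hvm : ∀ i, ModerateNumber fun ε => v ε i := fun i =>
    ⟨0, IsBigO.of_bound 1 (Eventually.of_forall fun ε => by
      simpa using (norm_le_pi_norm (v ε) i).trans (hv1 ε))⟩
  let y : CompactNet (chartImage e U) :=
    ⟨z, fun ε => hKU (hzK ε), K, hK, hKU, Eventually.of_forall hzK⟩
  let v' : Fin d → moderateSubring := fun i => ⟨fun ε => v ε i, hvm i⟩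
  have hker := hσ e he (Quotient.mk (compactNetSetoid _) y)
    (fun i => Ideal.Quotient.mk negligibleIdeal (v' i)) fun w => by
      have hz : Matrix.vecMul (fun i => Ideal.Quotient.mk negligibleIdeal (v' i))
          ((GenTensor.mk s).value e he (Quotient.mk (compactNetSetoid _) y)) = 0 := by
        ext j
        rw [value_mk]
        refine ((Ideal.Quotient.mk negligibleIdeal).map_vecMul _ v' j).symm.trans ?_
        refine Ideal.Quotient.eq_zero_iff_mem.2 fun m => ?_
        refine IsBigO.of_bound 1 ((hk m).mono fun ε hε => ?_)
        rw [vecMul_moderateMatrix_apply, one_mul, Real.norm_of_nonneg (pow_nonneg ε.2.1.le m)]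
        refine (norm_le_pi_norm (Matrix.vecMul (v ε) (localMatrix e (s.toFun ε) (z ε))) j).trans ?_
        by_cases hεS : ε ∈ S
        · exact (hvA ε hεS).trans (ε.pow_le_pow (hε hεS))
        · rw [hv0 ε hεS, Matrix.zero_vecMul, norm_zero]
          exact pow_nonneg ε.2.1.le m
      rw [toBilin'_apply_eq_vecMul, hz, zero_dotProduct]
  have hlt : ∀ᶠ ε in small, ∀ i, ‖v ε i‖ < 1 := by
    refine eventually_all.2 fun i => ?_
    have h1 : NegligibleNumber fun ε => v ε i :=
      Ideal.Quotient.eq_zero_iff_mem.1 (congrFun hker i)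
    obtain ⟨C, hC⟩ := (h1 1).bound
    refine (hC.and (eventually_mul_le_one (2 * C))).mono fun ε hε => ?_
    have h2 := hε.1
    rw [pow_one, Real.norm_of_nonneg ε.2.1.le] at h2
    linarith [hε.2]
  obtain ⟨ε, hεS, hε⟩ := (hS.and_eventually hlt).exists
  have h1 := (pi_norm_lt_iff one_pos).2 hε
  rw [hvS ε hεS] at h1
  exact lt_irrefl _ h1

end Volume

/-! ### Construction of nets of tensor fields -/

section Nets

variable {d : ℕ} {M : Type*} [TopologicalSpace M] [ChartedSpace (Euc d) M] [IsManifold (𝓡 d) ∞ M]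
  {U : Opens M}

/-- A net of tensor fields whose push-forwards by all charts are moderate families. -/
def TensorNet.ofLocalForm (s : Eps → TensorField d M)
    (h : ∀ e ∈ charts d M, ModerateFamily (chartImage e U) fun ε => localForm e (s ε)) :
    TensorNet (d := d) U where
  toFun := s
  smooth ε := smoothTensorOn_of_localForm fun x _ =>
    ⟨x, mem_chart_source _ x, (h _ (IsManifold.chart_mem_maximalAtlas x)).smooth ε⟩
  moderate := isModerate_of_localForm h

lemma ModerateFamily.bilinearComp {Ω : Set (Euc d)} (hΩ : IsOpen Ω)
    {f : Eps → Euc d → Euc d →L[ℝ] Euc d →L[ℝ] ℝ} (hf : ModerateFamily Ω f)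
    {A : Euc d → Euc d →L[ℝ] Euc d} (hA : ContDiffOn ℝ ∞ A Ω) :
    ModerateFamily Ω fun ε z => (f ε z).bilinearComp (A z) (A z) := by
  have hA' := moderateFamily_const hΩ hA
  have h1 := hf.bilinear hΩ (ContinuousLinearMap.compL ℝ (Euc d) (Euc d) (Euc d →L[ℝ] ℝ)) hA'
  have h2 := (h1.clm_comp hΩ flipL).bilinear hΩ
    (ContinuousLinearMap.compL ℝ (Euc d) (Euc d) (Euc d →L[ℝ] ℝ)) hA'
  exact h2.clm_comp hΩ flipL

lemma norm_bilinearComp_le (B : Euc d →L[ℝ] Euc d →L[ℝ] ℝ) (A : Euc d →L[ℝ] Euc d) :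
    ‖B.bilinearComp A A‖ ≤ ‖B‖ * (‖A‖ * ‖A‖) := by
  refine ContinuousLinearMap.opNorm_le_bound₂ _ (by positivity) fun v w => ?_
  rw [ContinuousLinearMap.bilinearComp_apply]
  calc ‖B (A v) (A w)‖ ≤ ‖B‖ * ‖A v‖ * ‖A w‖ := B.le_opNorm₂ _ _
    _ ≤ ‖B‖ * (‖A‖ * ‖v‖) * (‖A‖ * ‖w‖) := by gcongr <;> exact A.le_opNorm _
    _ = _ := by ring

lemma ModerateFamily.congr_eventually {E F : Type*} [NormedAddCommGroup E] [NormedSpace ℝ E]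
    [NormedAddCommGroup F] [NormedSpace ℝ F] {Ω : Set E} {f g : Eps → E → F}
    (hf : ModerateFamily Ω f) (hg : ∀ ε, ContDiffOn ℝ ∞ (g ε) Ω) (h : ∀ᶠ ε in small, g ε = f ε) :
    ModerateFamily Ω g where
  smooth := hg
  bound K hK hKΩ k := by
    obtain ⟨N, hN⟩ := hf.bound K hK hKΩ k
    refine ⟨N, (hN.and h).mono fun ε hε z hz => ?_⟩
    have := hε.1 z hz
    simpa only [hε.2] using this

lemma abs_extDerivOf_stdVec_le (T : Euc d →L[ℝ] Euc d →L[ℝ] Euc d →L[ℝ] ℝ) (i j k : Fin d) :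
    |extDerivOf T (stdVec i) (stdVec j) (stdVec k)| ≤ ‖T‖ * 3 := by
  have key : ∀ a b c : Fin d, |T (stdVec a) (stdVec b) (stdVec c)| ≤ ‖T‖ := fun a b c =>
    (abs_apply_stdVec_le _ b c).trans (by simpa using T.le_opNorm (stdVec a))
  have h1 := abs_add_le (T (stdVec i) (stdVec j) (stdVec k) - T (stdVec j) (stdVec i) (stdVec k))
    (T (stdVec k) (stdVec i) (stdVec j))
  have h2 := abs_sub (T (stdVec i) (stdVec j) (stdVec k)) (T (stdVec j) (stdVec i) (stdVec k))
  rw [extDerivOf]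
  linarith [key i j k, key j i k, key k i j]

end Nets

/-! ### From local symplectic representatives to a closed representative -/

section Skew

variable {d : ℕ} {M : Type*} [TopologicalSpace M] [ChartedSpace (Euc d) M]

/-- The skew-symmetric part of a tensor field. -/
noncomputable def skewPart (s : TensorField d M) : TensorField d M := fun x =>
  (2⁻¹ : ℝ) • (s.form x - (s.form x).flip)

lemma localForm_skewPart (e : OpenPartialHomeomorph M (Euc d)) (s : TensorField d M) (z : Euc d) :
    localForm e (skewPart s) z = (2⁻¹ : ℝ) • (localForm e s z - flipL (localForm e s z)) :=
  rfl

lemma flipL_localForm_of_isSkewOn {U : Opens M} {e : OpenPartialHomeomorph M (Euc d)}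
    {s : TensorField d M} (hs : IsSkewOn U s) {z : Euc d} (hz : z ∈ chartImage e U) :
    flipL (localForm e s z) = -localForm e s z := by
  ext v w
  exact hs (e.symm z) hz.2 (chartSymmDeriv e z w) (chartSymmDeriv e z v)

lemma norm_skewPart_sub_le {U : Opens M} {e : OpenPartialHomeomorph M (Euc d)}
    {s t : TensorField d M} (hs : IsSkewOn U s) {z : Euc d} (hz : z ∈ chartImage e U) :
    ‖localForm e (skewPart t) z - localForm e s z‖ ≤ ‖localForm e s z - localForm e t z‖ := by
  have h : localForm e (skewPart t) z - localForm e s z =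
      (2⁻¹ : ℝ) • (flipL (localForm e s z - localForm e t z) -
        (localForm e s z - localForm e t z)) := by
    rw [localForm_skewPart, map_sub, flipL_localForm_of_isSkewOn hs hz]
    module
  have h2 : ‖flipL (localForm e s z - localForm e t z)‖ = ‖localForm e s z - localForm e t z‖ :=
    ContinuousLinearMap.opNorm_flip _
  rw [h, norm_smul, Real.norm_of_nonneg (by norm_num)]
  linarith [norm_sub_le (flipL (localForm e s z - localForm e t z))
    (localForm e s z - localForm e t z)]

variable [IsManifold (𝓡 d) ∞ M]

/-- The net of skew-symmetric parts. -/
noncomputable def TensorNet.skewPart {U : Opens M} (t : TensorNet (d := d) U) :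
    TensorNet (d := d) U :=
  TensorNet.ofLocalForm (fun ε => Colombeau.skewPart (t.toFun ε)) fun e he => by
    have hO := isOpen_chartImage e U
    have h := ModerateFamily.localForm t he
    exact (h.sub hO (h.clm_comp hO flipL)).clm_comp hO ((2⁻¹ : ℝ) • ContinuousLinearMap.id ℝ _)

lemma exists_compact_nhds_chartImage {M : Type*} [TopologicalSpace M] {U : Opens M}
    {e : OpenPartialHomeomorph M (Euc d)} {z : Euc d} (hz : z ∈ chartImage e U) :
    ∃ L ∈ 𝓝 z, IsCompact L ∧ L ⊆ chartImage e U := by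
  obtain ⟨L, ⟨hL, hLc⟩, hLU⟩ :=
    (compact_basis_nhds z).mem_iff.1 ((isOpen_chartImage e U).mem_nhds hz)
  exact ⟨L, hL, hLc, hLU⟩

/-- If `σ` is represented locally by nets of symplectic forms, then the skew-symmetric part of any
representative is a representative by `2`-forms with negligible exterior derivative: near each
point it differs from a net of closed forms by a negligible net, whose derivatives are negligible
as well. -/
lemma exists_closed_representative {σ : GenTensor d (⊤ : Opens M)}
    (hσ : ∀ p : M, ∃ U : Opens M, p ∈ U ∧ ∃ s : TensorNet (d := d) U,
      GenTensor.mk s = σ.restrict (le_top : U ≤ ⊤) ∧ ∀ ε, IsSymplecticOn U (s.toFun ε)) :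
    ∃ s : TensorNet (d := d) (⊤ : Opens M), GenTensor.mk s = σ ∧
      (∀ ε, IsSkewOn ⊤ (s.toFun ε)) ∧ HasNegligibleExtDeriv ⊤ s.toFun := by
  obtain ⟨t, rfl⟩ : ∃ t, GenTensor.mk t = σ := Quotient.exists_rep σ
  have hloc : ∀ p : M, ∃ U : Opens M, p ∈ U ∧ ∃ s : TensorNet (d := d) U,
      DifferByNegligible U s.toFun t.toFun ∧ ∀ ε, IsSymplecticOn U (s.toFun ε) := by
    intro p
    obtain ⟨U, hpU, s, hs, hsymp⟩ := hσ p
    exact ⟨U, hpU, s, Quotient.exact hs, hsymp⟩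
  refine ⟨t.skewPart, Quotient.sound ?_, ?_, ?_⟩
  · refine differByNegligible_iff.2 fun e he K hK hKU => ?_
    refine uniformlyNegligibleOn_of_forall_mem_nhds hK fun z hz => ?_
    obtain ⟨U, hpU, s, hst, hs⟩ := hloc (e.symm z)
    obtain ⟨L, hL, hLc, hLU⟩ := exists_compact_nhds_chartImage (U := U) ⟨(hKU hz).1, hpU⟩
    have h1 := differByNegligible_iff.1 hst e he L hLc hLU
    -- Both `t` and its skew-symmetric part are within `‖s - t‖` of the skew-symmetric `s`.
    refine ⟨L, hL, (h1.add h1).mono_fun fun ε y hy => ?_⟩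
    have h2 := norm_skewPart_sub_le (t := t.toFun ε) (hs ε).skew (hLU hy)
    calc _ ≤ ‖localForm e (skewPart (t.toFun ε)) y - localForm e (s.toFun ε) y‖ +
          ‖localForm e (s.toFun ε) y - localForm e (t.toFun ε) y‖ :=
          norm_sub_le_norm_sub_add_norm_sub _ _ _
      _ ≤ _ := by gcongr
  · intro ε x _ v w
    change (2⁻¹ : ℝ) * ((t.toFun ε).form x v w - (t.toFun ε).form x w v) =
      -((2⁻¹ : ℝ) * ((t.toFun ε).form x w v - (t.toFun ε).form x v w))
    ring
  · intro e he K hK hKU i j k m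
    refine UniformlyNegligibleOn.exists_bound
      (a := fun ε z => |extDerivComponent e (t.skewPart.toFun ε) i j k z|) ?_ m
    refine uniformlyNegligibleOn_of_forall_mem_nhds hK fun z hz => ?_
    obtain ⟨U, hpU, s, hst, hs⟩ := hloc (e.symm z)
    obtain ⟨L, hL, hLc, hLU⟩ := exists_compact_nhds_chartImage (U := U) ⟨(hKU hz).1, hpU⟩
    have hO := isOpen_chartImage e U
    have hmt := (ModerateFamily.localForm t.skewPart he).mono
      (show chartImage e U ⊆ chartImage e ⊤ from fun y hy => ⟨hy.1, trivial⟩)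
    have hms := ModerateFamily.localForm s he
    have hneg := (hmt.sub hO hms).fderiv_negligible hO (fun K' hK' hK'U =>
      (differByNegligible_iff.1 hst e he K' hK' hK'U).mono_fun fun ε y hy =>
        norm_skewPart_sub_le (hs ε).skew (hK'U hy)) hLc hLU
    refine ⟨L, hL, (hneg.mul_moderate (uniformlyModerateOn_const 3)
      (fun _ _ _ => by norm_num)).mono_fun fun ε y hy => ?_⟩
    have hd1 : DifferentiableAt ℝ (localForm e (t.skewPart.toFun ε)) y :=
      ((hmt.smooth ε).contDiffAt (hO.mem_nhds (hLU hy))).differentiableAt (by simp)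
    have hd2 : DifferentiableAt ℝ (localForm e (s.toFun ε)) y :=
      ((hms.smooth ε).contDiffAt (hO.mem_nhds (hLU hy))).differentiableAt (by simp)
    have hclosed := (hs ε).closed e he y (hLU hy) i j k
    rw [extDerivComponent_eq hd2] at hclosed
    refine le_trans (le_of_eq ?_) (abs_extDerivOf_stdVec_le _ i j k)
    rw [extDerivComponent_eq hd1, fderiv_fun_sub hd1 hd2,
      ← sub_zero (extDerivOf _ _ _ _), ← hclosed]
    congr 1
    simp only [extDerivOf, sub_apply]
    ring

end Skew

/-! ### From a closed representative to local symplectic representatives -/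

section Local

variable {d : ℕ} {M : Type*} [TopologicalSpace M] [ChartedSpace (Euc d) M] [IsManifold (𝓡 d) ∞ M]

/-- A bilinear form is left non-degenerate: no non-zero vector pairs to zero with all others. -/
def NondegenerateForm (B : Euc d →L[ℝ] Euc d →L[ℝ] ℝ) : Prop :=
  ∀ v, (∀ w, B v w = 0) → v = 0

lemma det_eq_zero_of_not_nondegenerateForm {B : Euc d →L[ℝ] Euc d →L[ℝ] ℝ}
    (hB : ¬NondegenerateForm B) :
    (Matrix.of fun i j => B (stdVec i) (stdVec j)).det = 0 := by
  simp only [NondegenerateForm, not_forall] at hB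
  obtain ⟨v, hv, hv0⟩ := hB
  refine Matrix.exists_vecMul_eq_zero_iff.1 ⟨v.ofLp, fun h => hv0 ?_, ?_⟩
  · ext i
    exact congrFun h i
  · ext j
    have h := hv (stdVec j)
    rw [← sum_smul_stdVec v] at h
    simp only [map_sum, map_smul, sum_apply, smul_apply] at h
    exact h

/-- On a compactly contained ball in a chart, a net of `2`-forms with negligible exterior derivative
differs from its closed part by a negligible net. -/
lemma negligible_sub_closedPart {U : Opens M} (s : TensorNet (d := d) U)
    (hskew : ∀ ε, IsSkewOn U (s.toFun ε)) (hclosed : HasNegligibleExtDeriv U s.toFun)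
    {e : OpenPartialHomeomorph M (Euc d)} (he : e ∈ charts d M) {x₀ : Euc d} {r : ℝ}
    (hr : Metric.closedBall x₀ r ⊆ chartImage e U) :
    UniformlyNegligibleOn (Metric.ball x₀ r) fun ε z =>
      ‖localForm e (s.toFun ε) z - closedPart x₀ (localForm e (s.toFun ε)) z‖ := by
  have hball := Metric.ball_subset_closedBall.trans hr
  have hO := isOpen_chartImage e U
  have hsum : UniformlyNegligibleOn (Metric.closedBall x₀ r) fun ε z =>
      ∑ i, ∑ j, ∑ k, |extDerivComponent e (s.toFun ε) i j k z| :=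
    UniformlyNegligibleOn.sum _ fun i _ => UniformlyNegligibleOn.sum _ fun j _ =>
      UniformlyNegligibleOn.sum _ fun k _ => uniformlyNegligibleOn_of_bound
        (hclosed e he _ (isCompact_closedBall x₀ r) hr i j k)
  refine uniformlyNegligibleOn_of_bound fun m => ⟨r, (hsum m).mono fun ε hε z hz => ?_⟩
  have hsm := contDiffOn_localForm (s.smooth ε) he
  rw [mul_comm]
  refine norm_sub_closedPart_le (hsm.mono hball) (fun y hy u v => ?_)
    (pow_nonneg ε.2.1.le m) (fun y hy a u v => ?_) hz
  · exact hskew ε (e.symm y) (hball hy).2 (chartSymmDeriv e y u) (chartSymmDeriv e y v)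
  · have hd : DifferentiableAt ℝ (localForm e (s.toFun ε)) y :=
      (hsm.contDiffAt (hO.mem_nhds (hball hy))).differentiableAt (by simp)
    refine (abs_extDerivOf_le _ a u v).trans ?_
    have h1 := hε y (Metric.ball_subset_closedBall hy)
    simp only [extDerivComponent_eq hd] at h1
    gcongr

/-- If the volume is strictly positive, then a family of forms that differs from the push-forwards
of a representative by a negligible net is non-degenerate for small `ε`: at a net of points where
it degenerates, the determinant of the representative would be negligible. -/
lemma eventually_nondegenerateForm {U : Opens M} (s : TensorNet (d := d) U)
    (hvol : (GenTensor.mk s).VolStrictlyPositive)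
    {e : OpenPartialHomeomorph M (Euc d)} (he : e ∈ charts d M) {x₀ : Euc d} {r : ℝ} (hr0 : 0 < r)
    (hr : Metric.closedBall x₀ r ⊆ chartImage e U)
    {β : Eps → Euc d → Euc d →L[ℝ] Euc d →L[ℝ] ℝ}
    (hβ : UniformlyNegligibleOn (Metric.ball x₀ r) fun ε z =>
      ‖localForm e (s.toFun ε) z - β ε z‖) :
    ∀ᶠ ε in small, ∀ z ∈ Metric.ball x₀ r, NondegenerateForm (β ε z) := by
  by_contra hcon
  have hfreq : ∃ᶠ ε in small, ∃ z ∈ Metric.ball x₀ r, ¬NondegenerateForm (β ε z) := by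
    exact (not_eventually.1 hcon).mono fun ε hε => by simpa only [not_forall, exists_prop] using hε
  have hz : ∀ ε, ∃ z ∈ Metric.ball x₀ r, (∃ z ∈ Metric.ball x₀ r, ¬NondegenerateForm (β ε z)) →
      ¬NondegenerateForm (β ε z) := by
    intro ε
    by_cases h : ∃ z ∈ Metric.ball x₀ r, ¬NondegenerateForm (β ε z)
    · obtain ⟨z, hz, hd⟩ := h
      exact ⟨z, hz, fun _ => hd⟩
    · exact ⟨x₀, Metric.mem_ball_self hr0, fun h' => absurd h' h⟩
  choose z hzb hz using hz
  let y : CompactNet (chartImage e U) :=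
    ⟨z, fun ε => hr (Metric.ball_subset_closedBall (hzb ε)), Metric.closedBall x₀ r,
      isCompact_closedBall x₀ r, hr,
      Eventually.of_forall fun ε => Metric.ball_subset_closedBall (hzb ε)⟩
  have hdet := negligible_det_sub_det (moderateNumber_component s he y)
    (b := fun i j ε => β ε (z ε) (stdVec i) (stdVec j)) fun i j m => by
      refine isBigO_of_eventually_le 1 ((hβ m).mono fun ε hε => ?_)
        fun ε => pow_nonneg ε.2.1.le m
      rw [one_mul]
      exact (abs_apply_stdVec_le (localForm e (s.toFun ε) (z ε) - β ε (z ε)) i j).trans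
        (hε _ (hzb ε))
  obtain ⟨m, hm⟩ := hvol s rfl e he _ (isCompact_closedBall x₀ r) hr
  obtain ⟨C, hC⟩ := (hdet (m * 2 + 1)).bound
  obtain ⟨ε, hdeg, hm, hC, hsmall⟩ :=
    (hfreq.and_eventually (hm.and (hC.and (eventually_mul_le_one (2 * C))))).exists
  have h0 : (0 : ℝ) < (ε : ℝ) ^ (m * 2) := pow_pos ε.2.1 _
  have h1 := pow_le_pow_left₀ (pow_nonneg ε.2.1.le m)
    (hm (z ε) (Metric.ball_subset_closedBall (hzb ε))) 2
  rw [volCoeff_sq, ← pow_mul] at h1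
  rw [Pi.sub_apply, det_eq_zero_of_not_nondegenerateForm (hz ε hdeg), sub_zero,
    Real.norm_of_nonneg (pow_nonneg ε.2.1.le _), Real.norm_eq_abs] at hC
  have h2 : (ε : ℝ) ^ (m * 2) ≤ C * (ε : ℝ) ^ (m * 2 + 1) := h1.trans hC
  have h3 : C * (ε : ℝ) ^ (m * 2 + 1) = (2 * C * ε) * (ε : ℝ) ^ (m * 2) / 2 := by ring
  have h4 : (2 * C * ε) * (ε : ℝ) ^ (m * 2) ≤ 1 * (ε : ℝ) ^ (m * 2) := by gcongr
  linarith

variable {e : OpenPartialHomeomorph M (Euc d)}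

/-- The part of the domain of the chart `e` that is mapped into the open ball. -/
def chartBall {M : Type*} [TopologicalSpace M] (e : OpenPartialHomeomorph M (Euc d))
    (x₀ : Euc d) (r : ℝ) : Opens M :=
  ⟨e.source ∩ e ⁻¹' Metric.ball x₀ r, e.isOpen_inter_preimage Metric.isOpen_ball⟩

lemma chartImage_chartBall_subset {M : Type*} [TopologicalSpace M]
    {e e' : OpenPartialHomeomorph M (Euc d)} (x₀ : Euc d) (r : ℝ) :
    chartImage e' (chartBall e x₀ r) ⊆ e'.target ∩ e'.symm ⁻¹' e.source :=
  fun _ hz => ⟨hz.1, hz.2.1⟩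

/-- A moderate family of forms on a ball in the image of a chart, as a net of tensor fields. -/
noncomputable def TensorNet.ofChart (he : e ∈ charts d M) {x₀ : Euc d} {r : ℝ}
    (β : Eps → Euc d → Euc d →L[ℝ] Euc d →L[ℝ] ℝ) (hβ : ModerateFamily (Metric.ball x₀ r) β) :
    TensorNet (d := d) (chartBall e x₀ r) :=
  TensorNet.ofLocalForm (fun ε => chartPullback e (β ε)) fun e' he' => by
    have hO := isOpen_chartImage e' (chartBall e x₀ r)
    have hτ := (contDiffOn_coordChange he he').mono (chartImage_chartBall_subset x₀ r)
    exact ((hβ.comp Metric.isOpen_ball hO hτ fun z hz => hz.2.2).bilinearComp hO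
      (hτ.fderiv_of_isOpen hO (by simp))).congr hO fun ε z hz =>
        localForm_chartPullback_coordChange he he' _ (chartImage_chartBall_subset x₀ r hz)

lemma differByNegligible_ofChart {U : Opens M} (he : e ∈ charts d M) {x₀ : Euc d} {r : ℝ}
    {β : Eps → Euc d → Euc d →L[ℝ] Euc d →L[ℝ] ℝ} (hβ : ModerateFamily (Metric.ball x₀ r) β)
    (s : TensorNet (d := d) U)
    (hs : UniformlyNegligibleOn (Metric.ball x₀ r) fun ε z =>
      ‖localForm e (s.toFun ε) z - β ε z‖) :
    DifferByNegligible (chartBall e x₀ r) (TensorNet.ofChart he β hβ).toFun s.toFun := by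
  refine differByNegligible_iff.2 fun e' he' K hK hKU => ?_
  have hsub := hKU.trans (chartImage_chartBall_subset x₀ r)
  have hτ : ContinuousOn (fun z => ‖fderiv ℝ (e ∘ e'.symm) z‖) K :=
    (((contDiffOn_coordChange he he').continuousOn_fderiv_of_isOpen isOpen_coordChange_source
      (by simp)).mono hsub).norm
  have h := (hs.comp (τ := e ∘ e'.symm) (L := K) fun z hz => (hKU hz).2.2).mul_moderate
    (uniformlyModerateOn_of_continuousOn hK (hτ.mul hτ)) fun _ _ _ => mul_self_nonneg _
  refine h.mono_fun fun ε z hz => ?_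
  have h1 : localForm e' ((TensorNet.ofChart he β hβ).toFun ε) z - localForm e' (s.toFun ε) z =
      -((localForm e (s.toFun ε) ((e ∘ e'.symm) z) - β ε ((e ∘ e'.symm) z)).bilinearComp
        (fderiv ℝ (e ∘ e'.symm) z) (fderiv ℝ (e ∘ e'.symm) z)) := by
    rw [localForm_coordChange he he' (s.toFun ε) (hsub hz)]
    refine (congrArg (· - _) (localForm_chartPullback_coordChange he he' (β ε) (hsub hz))).trans ?_
    ext v w
    simp
  rw [h1, norm_neg]
  exact norm_bilinearComp_le _ _

lemma isSymplecticOn_chartPullback (he : e ∈ charts d M) {x₀ : Euc d} {r : ℝ}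
    (hr : Metric.ball x₀ r ⊆ e.target) {β : Euc d → Euc d →L[ℝ] Euc d →L[ℝ] ℝ}
    (hsmooth : SmoothTensorOn (chartBall e x₀ r) (chartPullback e β))
    (hskew : ∀ z u v, β z u v = -β z v u)
    (hclosed : ∀ z ∈ Metric.ball x₀ r, ∀ u v w, extDerivOf (fderiv ℝ β z) u v w = 0)
    (hnondeg : ∀ z ∈ Metric.ball x₀ r, NondegenerateForm (β z)) :
    IsSymplecticOn (chartBall e x₀ r) (chartPullback e β) := by
  have hsk : IsSkewOn (chartBall e x₀ r) (chartPullback e β) := fun x _ v w =>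
    hskew (e x) (chartDeriv e x v) (chartDeriv e x w)
  refine ⟨hsmooth, hsk, fun x hx v hv => ?_, fun e' he' z hz i j k => ?_⟩
  · have h0 : chartDeriv e x v = 0 := hnondeg (e x) hx.2 _ fun w => by
      have h1 : β (e x) (chartDeriv e x v) (chartDeriv e x (chartSymmDeriv e (e x) w)) = 0 :=
        hv (chartSymmDeriv e (e x) w)
      have h2 := chartDeriv_chartSymmDeriv he (e.map_source hx.1) w
      rw [e.left_inv hx.1] at h2
      rwa [h2] at h1
    have h3 := chartSymmDeriv_chartDeriv he hx.1 v
    rw [h0, map_zero] at h3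
    exact h3.symm
  · have hze := chartImage_chartBall_subset x₀ r hz
    refine extDerivComponent_eq_zero_of_chart hsmooth hsk he he' hz hze.2 (fun u v w => ?_) i j k
    have hmem : e (e'.symm z) ∈ Metric.ball x₀ r := hz.2.2
    have heq : localForm e (chartPullback e β) =ᶠ[𝓝 (e (e'.symm z))] β := by
      filter_upwards [Metric.isOpen_ball.mem_nhds hmem] with y hy
      exact localForm_chartPullback he β (hr hy)
    rw [heq.fderiv_eq]
    exact hclosed _ hmem u v w

lemma exists_local_symplectic_representative {σ : GenTensor d (⊤ : Opens M)} (hσ : σ.IsSymplectic)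
    (hvol : σ.VolStrictlyPositive) (p : M) :
    ∃ U : Opens M, p ∈ U ∧ ∃ s : TensorNet (d := d) U,
      GenTensor.mk s = σ.restrict (le_top : U ≤ ⊤) ∧ ∀ ε, IsSymplecticOn U (s.toFun ε) := by
  obtain ⟨s, rfl, hskew, hclosed⟩ := hσ.closed_form
  set e := chartAt (Euc d) p
  have he : e ∈ charts d M := IsManifold.chart_mem_maximalAtlas p
  have hp : p ∈ e.source := mem_chart_source _ p
  have hmem : e p ∈ chartImage e (⊤ : Opens M) := ⟨e.map_source hp, trivial⟩
  obtain ⟨r, hr0, hr⟩ :=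
    Metric.nhds_basis_closedBall.mem_iff.1 ((isOpen_chartImage e ⊤).mem_nhds hmem)
  set x₀ := e p
  have hball : Metric.ball x₀ r ⊆ chartImage e ⊤ := Metric.ball_subset_closedBall.trans hr
  have hβ := (ModerateFamily.localForm s he).mono hball
  set η : Eps → Euc d → Euc d →L[ℝ] Euc d →L[ℝ] ℝ :=
    fun ε => closedPart x₀ (localForm e (s.toFun ε))
  have hηm : ModerateFamily (Metric.ball x₀ r) η := hβ.closedPart
  have hneg := negligible_sub_closedPart s hskew hclosed he hr
  have hgood := eventually_nondegenerateForm s hvol he hr0 hr hneg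
  obtain ⟨ε₀, hε₀⟩ := hgood.exists
  -- Only small parameters are known to give a non-degenerate form; `η ε₀` replaces the others.
  classical
  let c : Eps → Eps := fun ε =>
    if ∀ z ∈ Metric.ball x₀ r, NondegenerateForm (η ε z) then ε else ε₀
  have hc : ∀ᶠ ε in small, c ε = ε := hgood.mono fun ε hε => if_pos hε
  have hcn : ∀ ε, ∀ z ∈ Metric.ball x₀ r, NondegenerateForm (η (c ε) z) := by
    intro ε
    by_cases h : ∀ z ∈ Metric.ball x₀ r, NondegenerateForm (η ε z)
    · rw [show c ε = ε from if_pos h]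
      exact h
    · rw [show c ε = ε₀ from if_neg h]
      exact hε₀
  have hηc : ModerateFamily (Metric.ball x₀ r) fun ε => η (c ε) :=
    hηm.congr_eventually (fun ε => hηm.smooth (c ε)) (hc.mono fun ε hε => by rw [hε])
  refine ⟨chartBall e x₀ r, ⟨hp, Metric.mem_ball_self hr0⟩,
    TensorNet.ofChart he (fun ε => η (c ε)) hηc, ?_, fun ε => ?_⟩
  · refine Quotient.sound (differByNegligible_ofChart he hηc s fun m => ?_)
    refine ((hneg m).and hc).mono fun ε hε z hz => ?_
    have := hε.1 z hz
    simpa only [hε.2] using this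
  · exact isSymplecticOn_chartPullback he (hball.trans Set.inter_subset_left)
      ((TensorNet.ofChart he (fun ε => η (c ε)) hηc).smooth ε)
      (fun z u v => closedPart_skew _ _ z u v)
      (fun z hz u v w => extDerivOf_fderiv_closedPart (hβ.smooth (c ε)) hz u v w) (hcn ε)

end Local

end Colombeau

theorem mainTheorem3 {d : ℕ} {M : Type*} [TopologicalSpace M] [T2Space M]
    [SecondCountableTopology M] [ChartedSpace (EuclideanSpace ℝ (Fin d)) M]
    [IsManifold (𝓡 d) ∞ M] (σ : Colombeau.GenTensor d (⊤ : TopologicalSpace.Opens M)) :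
    σ.IsSymplectic ↔
      σ.VolStrictlyPositive ∧
        ∀ p : M, ∃ U : TopologicalSpace.Opens M, p ∈ U ∧
          ∃ s : Colombeau.TensorNet (d := d) U,
            Colombeau.GenTensor.mk s = σ.restrict (le_top : U ≤ ⊤) ∧
              ∀ ε, Colombeau.IsSymplecticOn U (s.toFun ε) := by
  refine ⟨fun h => ?_, fun h => ⟨Colombeau.exists_closed_representative h.2,
    fun _ he z _ hv => Colombeau.nondegenerate_of_volStrictlyPositive h.1 he z hv⟩⟩
  have hvol := Colombeau.volStrictlyPositive_of_nondegenerate h.nondegenerate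
  exact ⟨hvol, Colombeau.exists_local_symplectic_representative h hvol⟩
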